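/- Let $R\in(0,\infty]$ and let $\vartheta\colon\mathbb{R}\to\mathbb{R}$ be smooth. Suppose that for some pair $f_1,f_2$ of linearly independent solutions of $f''+\vartheta f=0$ on $\mathbb{R}$, with (constant, nonzero) Wronskian $W=f_1f_2'-f_1'f_2$, the quotient $h=f_2/f_1$ extends meromorphically to $\{z\in\mathbb{C} : |\operatorname{Im} z|<R\}$ and analytically to $\{0<\operatorname{Im} z<R\}$, with $W\cdot\operatorname{Im}h(z)\cdot\operatorname{Im}z>0$ on $\{0<\operatorname{Im} z<R\}$. Let $g_R(t)=-\frac{R}{\pi}\ln\left(1-\frac{\pi t}{R}\right)$ if $R<\infty$ and $g_\infty(t)=t$. For any pair $u_1,u_2$ of linearly independent solutions of $f''+\vartheta f=0$ put $$\mathbf F(t)=\begin{bmatrix}u_1(t)&u_1'(t)\\u_2(t)&u_2'(t)\end{bmatrix},\qquad \mathbf F(x,t)=\mathbf F(x)^{-1}\mathbf F(t),\qquad V(x,t)=\frac{\mathbf F(x,t)_{2,1}}{\mathbf F(x,t)_{1,1}},$$ the last for $t$ near $x$, and define the $g_R$-Schwarzians $$\mathcal S_n^{\vartheta,g_R}(x)=\frac{\partial^n}{\partial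 t^n}V(x,x+g_R(t))\Big|_{t=0},\qquad n\ge 1,$$ which do not depend on the choice of $u_1,u_2$. Then for every $x\in\mathbb{R}$ there is a non-negative Borel measure $\mu$ on $\mathbb{R}$ with finite moments such that $$\mathcal S_n^{\vartheta,g_R}(x)=n!\int_{\mathbb R}t^{n-1}\,d\mu(t)\qquad\text{for all integers } n\ge1,$$ and every such measure $\mu$ satisfies, when $\sup\vartheta=\sup_{x\in\mathbb{R}}\vartheta(x)$ is finite: (1) if $\sup\vartheta\le 0$, then $\operatorname{supp}\mu\subset\left[-\frac{\pi}{R},\frac{\pi}{R}\right]$, interpreted as $\{0\}$ if $R=\infty$; (2) if $\sup\vartheta>0$, then $\operatorname{supp}\mu\subset[-A,A]$ with $$A=\frac{\pi}{R-R\,e^{-\pi^2/(2R\sqrt{\sup\vartheta})}},$$ interpreted as $A=\frac{2\sqrt{\sup\vartheta}}{\pi}$ if $R=\infty$. -/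

import Mathlib

open Set MeasureTheory
open scoped ENNReal ContDiff

noncomputable section

namespace StripSchwarzian

/-- `f` is a solution on all of `ℝ` of the equation `f'' + ϑ f = 0`. -/
def IsSolution (ϑ f : ℝ → ℝ) : Prop :=
  Differentiable ℝ f ∧ Differentiable ℝ (deriv f) ∧
    ∀ t : ℝ, deriv (deriv f) t + ϑ t * f t = 0

/-- `f₁, f₂` is a pair of linearly independent solutions of `f'' + ϑ f = 0`. -/
structure IsSolutionPair (ϑ f₁ f₂ : ℝ → ℝ) : Prop where
  left : IsSolution ϑ f₁
  right : IsSolution ϑ f₂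
  indep : LinearIndependent ℝ ![f₁, f₂]

/-- The Wronskian `W(f₁, f₂) = f₁ f₂' - f₁' f₂` at `t`
(constant in `t` for two solutions of `f'' + ϑ f = 0`). -/
def wronskian (f₁ f₂ : ℝ → ℝ) (t : ℝ) : ℝ :=
  f₁ t * deriv f₂ t - deriv f₁ t * f₂ t

/-- The matrix `F(t)` with rows `(f₁, f₁')` and `(f₂, f₂')`. -/
def solMatrix (f₁ f₂ : ℝ → ℝ) (t : ℝ) : Matrix (Fin 2) (Fin 2) ℝ :=
  !![f₁ t, deriv f₁ t; f₂ t, deriv f₂ t]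

/-- `F(x, t) = F(x)⁻¹ F(t)`. -/
def transMatrix (f₁ f₂ : ℝ → ℝ) (x t : ℝ) : Matrix (Fin 2) (Fin 2) ℝ :=
  (solMatrix f₁ f₂ x)⁻¹ * solMatrix f₁ f₂ t

/-- `V(x, t) = F(x, t)₂₁ / F(x, t)₁₁`, meaningful for `t` near `x`. -/
def V (f₁ f₂ : ℝ → ℝ) (x t : ℝ) : ℝ :=
  transMatrix f₁ f₂ x t 1 0 / transMatrix f₁ f₂ x t 0 0

/-- The function `g_R(t) = -(R/π) ln (1 - π t / R)` near `t = 0` on the real line, and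
`g_∞(t) = t`. -/
def gR (R : ℝ≥0∞) (t : ℝ) : ℝ :=
  if R = ⊤ then t
  else -(R.toReal / Real.pi) * Real.log (1 - Real.pi * t / R.toReal)

/-- The `g_R`-Schwarzian of order `n` at `x` of the equation solved by `f₁, f₂`: the `n`-th
derivative at `t = 0` of `V(x, x + g_R(t))`. -/
def gSchwarzian (R : ℝ≥0∞) (f₁ f₂ : ℝ → ℝ) (n : ℕ) (x : ℝ) : ℝ :=
  iteratedDeriv n (fun t : ℝ => V f₁ f₂ x (x + gR R t)) 0

/-- The strip `|Im z| < R`. -/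
def strip (R : ℝ≥0∞) : Set ℂ := {z | ENNReal.ofReal |z.im| < R}

/-- The upper half `0 < Im z < R` of the strip. -/
def upperStrip (R : ℝ≥0∞) : Set ℂ := {z | 0 < z.im ∧ ENNReal.ofReal z.im < R}

/-- `h = f₂ / f₁` extends meromorphically to the strip `|Im z| < R`, analytically to
`0 < Im z < R`, with `W(f₁, f₂) · Im h(z) · Im z > 0` there. -/
def QuotientExtends (R : ℝ≥0∞) (f₁ f₂ : ℝ → ℝ) : Prop :=
  ∃ H : ℂ → ℂ,
    MeromorphicOn H (strip R) ∧
    AnalyticOnNhd ℂ H (upperStrip R) ∧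
    (∀ z ∈ upperStrip R, 0 < wronskian f₁ f₂ 0 * (H z).im * z.im) ∧
    ∀ t : ℝ, f₁ t ≠ 0 → H (t : ℂ) = ((f₂ t / f₁ t : ℝ) : ℂ)

/-- The Borel measure `μ` represents the real sequence `S₁, S₂, …` as moments:
`S n = n! ∫ t ^ (n - 1) dμ(t)` for all `n ≥ 1`, the moments being finite. -/
def RepresentsAsMoments (S : ℕ → ℝ) (μ : Measure ℝ) : Prop :=
  ∀ n : ℕ, 1 ≤ n →
    Integrable (fun t : ℝ => t ^ (n - 1)) μ ∧
      S n = (n.factorial : ℝ) * ∫ t : ℝ, t ^ (n - 1) ∂μ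

/-- `π / R`, read as `0` for `R = ∞`. -/
def boundNonpos (R : ℝ≥0∞) : ℝ :=
  if R = ⊤ then 0 else Real.pi / R.toReal

/-- `π / (R - R exp (-π² / (2 R √K)))`, read as `2 √K / π` for `R = ∞`. -/
def boundPos (R : ℝ≥0∞) (K : ℝ) : ℝ :=
  if R = ⊤ then 2 * Real.sqrt K / Real.pi
  else Real.pi / (R.toReal - R.toReal *
    Real.exp (-(Real.pi ^ 2 / (2 * R.toReal * Real.sqrt K))))

end StripSchwarzian

end

/-!
Fix `x` and let `c`, `s` be the solutions with data `(1, 0)` and `(0, 1)` at `x`. Then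
`V(x, t) = s(t) / c(t)` is a real Möbius transform of `h = f₂ / f₁` with determinant the Wronskian,
so it continues meromorphically to the strip, maps its upper half into the upper half-plane, and by
Schwarz reflection is holomorphic off the real zeros of `c`
(`differentiableAt_reflectedV_ofReal`, `reflectedV_im_pos`). As `g_R` maps the upper half-plane into
the upper half of the strip, `φ(w) = V(x, x + g_R(w))` is a Pick function that is holomorphic and
real near `0` (`pickV`), and the Schwarzians at `x` are its derivatives at `0`.

The Taylor coefficients of such a function are moments (`exists_measure_of_pick`): with
`G(ζ) = φ(1 / ζ)`, which has non-negative imaginary part below the real axis, Cauchy's theorem on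
`[-B, B] × [-B, 0]` expresses `∫ tⁿ Im G(t - iε) dt` over `[-B, B]` by an integral over the
three other sides. This converges as `ε → 0`, and since `ζⁿ G(ζ)` has, apart from its residue term,
a primitive that is real on the real axis outside a disc, the limit is `π` times the coefficient of
order `n + 1`. The positive densities `Im G(t - iε) / π` thus have convergent moments, and a weak
limit of them is the measure.

Conversely, by Cauchy's estimates, moments that are the Taylor coefficients of a function holomorphic
in a disc of radius `ρ` force the support into `[-1/ρ, 1/ρ]` (`support_subset_of_moments`). If `c` has
no zero at distance less than `d` from `x`, the function `φ` is holomorphic in the disc of radius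
`(R/π)(1 - exp(-π d / R))`, read as `d` for `R = ∞`. For `ϑ ≤ K` with `K > 0`, Sturm comparison
gives `d = π / (2 √K)`, which is the asserted bound; the case `sup ϑ ≤ 0` follows on letting `K`
tend to `0`.
-/

namespace StripSchwarzian

open Filter Topology Complex Metric

/-! ### Second order linear equations -/

lemma IsSolution.hasDerivAt {ϑ f : ℝ → ℝ} (hf : IsSolution ϑ f) (t : ℝ) :
    HasDerivAt f (deriv f t) t := (hf.1 t).hasDerivAt

lemma IsSolution.hasDerivAt_deriv {ϑ f : ℝ → ℝ} (hf : IsSolution ϑ f) (t : ℝ) :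
    HasDerivAt (deriv f) (-(ϑ t * f t)) t := by
  have h := (hf.2.1 t).hasDerivAt
  have h2 := hf.2.2 t
  rwa [show deriv (deriv f) t = -(ϑ t * f t) by linarith] at h

lemma IsSolution.of_hasDerivAt {ϑ f g : ℝ → ℝ} (h₁ : ∀ t, HasDerivAt f (g t) t)
    (h₂ : ∀ t, HasDerivAt g (-(ϑ t * f t)) t) : IsSolution ϑ f := by
  have hd : deriv f = g := funext fun t => (h₁ t).deriv
  refine ⟨fun t => (h₁ t).differentiableAt, ?_, fun t => ?_⟩
  · rw [hd]; exact fun t => (h₂ t).differentiableAt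
  · rw [hd, (h₂ t).deriv]; ring

lemma IsSolution.comb {ϑ f g : ℝ → ℝ} (hf : IsSolution ϑ f) (hg : IsSolution ϑ g) (a b : ℝ) :
    IsSolution ϑ (fun t => a * f t + b * g t) := by
  refine IsSolution.of_hasDerivAt (g := fun t => a * deriv f t + b * deriv g t) (fun t => ?_)
    fun t => ?_
  · exact ((hf.hasDerivAt t).const_mul a).add ((hg.hasDerivAt t).const_mul b)
  · refine (((hf.hasDerivAt_deriv t).const_mul a).add
      ((hg.hasDerivAt_deriv t).const_mul b)).congr_deriv ?_
    ring

lemma IsSolution.deriv_comb {ϑ f g : ℝ → ℝ} (hf : IsSolution ϑ f) (hg : IsSolution ϑ g)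
    (a b t : ℝ) : deriv (fun t => a * f t + b * g t) t = a * deriv f t + b * deriv g t :=
  (((hf.hasDerivAt t).const_mul a).add ((hg.hasDerivAt t).const_mul b)).deriv

/-- Grönwall's argument for the energy `f² + f'²` of a solution with zero data, to the right of
the initial point. -/
lemma IsSolution.eq_zero_of_le {ϑ f : ℝ → ℝ} (hϑ : Continuous ϑ) (hf : IsSolution ϑ f) {x : ℝ}
    (h₀ : f x = 0) (h₁ : deriv f x = 0) {t : ℝ} (ht : x ≤ t) : f t = 0 := by
  obtain ⟨C, hC⟩ := isCompact_Icc.exists_bound_of_continuousOn (s := Icc x t) hϑ.continuousOn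
  let E : ℝ → ℝ := fun s => (f s ^ 2 + deriv f s ^ 2) * Real.exp (-(1 + C) * s)
  have hE : ∀ s, HasDerivAt E
      ((2 * f s * deriv f s + 2 * deriv f s * (-(ϑ s * f s))) * Real.exp (-(1 + C) * s) +
        (f s ^ 2 + deriv f s ^ 2) * (Real.exp (-(1 + C) * s) * (-(1 + C)))) s := by
    intro s
    have a := ((hf.hasDerivAt s).pow 2).add ((hf.hasDerivAt_deriv s).pow 2)
    have b : HasDerivAt (fun s => Real.exp (-(1 + C) * s))
        (Real.exp (-(1 + C) * s) * (-(1 + C))) s := by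
      simpa using (((hasDerivAt_id s).const_mul (-(1 + C))).exp)
    refine (a.mul b).congr_deriv ?_
    simp
  have hanti : AntitoneOn E (Icc x t) := by
    refine antitoneOn_of_deriv_nonpos (convex_Icc x t)
      (fun s _ => (hE s).continuousAt.continuousWithinAt)
      (fun s _ => (hE s).differentiableAt.differentiableWithinAt) fun s hs => ?_
    rw [interior_Icc] at hs
    have hb : |ϑ s| ≤ C := hC s ⟨hs.1.le, hs.2.le⟩
    rw [(hE s).deriv]
    have key : 2 * f s * deriv f s + 2 * deriv f s * (-(ϑ s * f s))
        - (f s ^ 2 + deriv f s ^ 2) * (1 + C) ≤ 0 := by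
      have := abs_le.1 hb
      nlinarith [mul_nonneg (sub_nonneg.2 this.2) (sq_nonneg (f s - deriv f s)),
        mul_nonneg (by linarith : 0 ≤ C + ϑ s) (sq_nonneg (f s + deriv f s)),
        sq_nonneg (f s - deriv f s)]
    nlinarith [mul_nonneg (sub_nonneg.2 key) (Real.exp_pos (-(1 + C) * s)).le]
  have h := hanti (left_mem_Icc.2 ht) (right_mem_Icc.2 ht) ht
  have hx : E x = 0 := by simp [E, h₀, h₁]
  rw [hx] at h
  have h3 : f t ^ 2 + deriv f t ^ 2 ≤ 0 := by
    by_contra hne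
    exact absurd h (not_le.2 (mul_pos (not_le.1 hne) (Real.exp_pos _)))
  nlinarith [sq_nonneg (f t), sq_nonneg (deriv f t)]

lemma IsSolution.comp_neg {ϑ f : ℝ → ℝ} (hf : IsSolution ϑ f) :
    IsSolution (fun t => ϑ (-t)) (fun t => f (-t)) := by
  refine IsSolution.of_hasDerivAt (g := fun t => -deriv f (-t)) (fun t => ?_) fun t => ?_
  · exact ((hf.hasDerivAt (-t)).scomp t (hasDerivAt_neg t)).congr_deriv (by simp)
  · exact ((hf.hasDerivAt_deriv (-t)).scomp t (hasDerivAt_neg t)).neg.congr_deriv (by simp)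

lemma IsSolution.eq_zero {ϑ f : ℝ → ℝ} (hϑ : Continuous ϑ) (hf : IsSolution ϑ f) {x : ℝ}
    (h₀ : f x = 0) (h₁ : deriv f x = 0) (t : ℝ) : f t = 0 := by
  rcases le_total x t with h | h
  · exact hf.eq_zero_of_le hϑ h₀ h₁ h
  · have := hf.comp_neg.eq_zero_of_le (x := -x) (t := -t) (hϑ.comp continuous_neg) (by simpa)
      (by rw [deriv_comp_neg]; simpa) (by linarith)
    simpa using this

lemma IsSolution.wronskian_eq {ϑ f g : ℝ → ℝ} (hf : IsSolution ϑ f) (hg : IsSolution ϑ g)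
    (s t : ℝ) : wronskian f g s = wronskian f g t := by
  have h : ∀ s, HasDerivAt (wronskian f g) 0 s := fun s => by
    have := ((hf.hasDerivAt s).mul (hg.hasDerivAt_deriv s)).sub
      ((hf.hasDerivAt_deriv s).mul (hg.hasDerivAt s))
    exact this.congr_deriv (by ring)
  exact is_const_of_deriv_eq_zero (fun s => (h s).differentiableAt) (fun s => (h s).deriv) s t

lemma IsSolutionPair.wronskian_ne_zero {ϑ f g : ℝ → ℝ} (hϑ : Continuous ϑ)
    (h : IsSolutionPair ϑ f g) (x : ℝ) : wronskian f g x ≠ 0 := by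
  intro hW
  unfold wronskian at hW
  have hind := LinearIndependent.pair_iff.1 h.indep
  -- a combination of `f` and `g` with zero data at `x` is trivial
  have key : ∀ a b : ℝ, a * f x + b * g x = 0 → a * deriv f x + b * deriv g x = 0 →
      a = 0 ∧ b = 0 := fun a b h₀ h₁ => by
    refine hind a b (funext fun t => ?_)
    have := (h.left.comb h.right a b).eq_zero hϑ (x := x) h₀
      (by rw [h.left.deriv_comb h.right]; exact h₁) t
    simpa using this
  obtain ⟨hg, hf⟩ := key (g x) (-f x) (by ring) (by linarith)
  obtain ⟨hg', hf'⟩ := key (deriv g x) (-deriv f x) (by linarith) (by ring)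
  have := (key 1 0 (by linarith) (by linarith)).1
  norm_num at this

/-- The solution with value `1` and derivative `0` at `x`, in terms of a pair of independent
solutions. -/
noncomputable def cosSol (u₁ u₂ : ℝ → ℝ) (x t : ℝ) : ℝ :=
  deriv u₂ x / wronskian u₁ u₂ x * u₁ t + -deriv u₁ x / wronskian u₁ u₂ x * u₂ t

/-- The solution with value `0` and derivative `1` at `x`, in terms of a pair of independent
solutions. -/
noncomputable def sinSol (u₁ u₂ : ℝ → ℝ) (x t : ℝ) : ℝ :=
  -u₂ x / wronskian u₁ u₂ x * u₁ t + u₁ x / wronskian u₁ u₂ x * u₂ t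

section
variable {ϑ u₁ u₂ f₁ f₂ : ℝ → ℝ}

lemma V_eq (u₁ u₂ : ℝ → ℝ) (x t : ℝ) : V u₁ u₂ x t = sinSol u₁ u₂ x t / cosSol u₁ u₂ x t := by
  have hdet : (solMatrix u₁ u₂ x).det = wronskian u₁ u₂ x := by
    simp [solMatrix, Matrix.det_fin_two, wronskian]
  unfold V transMatrix sinSol cosSol
  rw [Matrix.inv_def, hdet]
  simp only [solMatrix, Matrix.adjugate_fin_two_of, Ring.inverse_eq_inv', Matrix.smul_of,
    Matrix.smul_cons, Matrix.smul_empty, smul_eq_mul]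
  simp [Matrix.mul_apply, Fin.sum_univ_two]
  congr 1 <;> ring

lemma IsSolutionPair.cosSol_isSolution (h : IsSolutionPair ϑ u₁ u₂) (x : ℝ) :
    IsSolution ϑ (cosSol u₁ u₂ x) := h.left.comb h.right _ _

lemma IsSolutionPair.sinSol_isSolution (h : IsSolutionPair ϑ u₁ u₂) (x : ℝ) :
    IsSolution ϑ (sinSol u₁ u₂ x) := h.left.comb h.right _ _

lemma IsSolutionPair.cosSol_self (hϑ : Continuous ϑ) (h : IsSolutionPair ϑ u₁ u₂) (x : ℝ) :
    cosSol u₁ u₂ x x = 1 := by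
  have := h.wronskian_ne_zero hϑ x
  unfold cosSol
  field_simp
  unfold wronskian; ring

lemma IsSolutionPair.deriv_cosSol_self (h : IsSolutionPair ϑ u₁ u₂) (x : ℝ) :
    deriv (cosSol u₁ u₂ x) x = 0 := by
  unfold cosSol
  rw [h.left.deriv_comb h.right]
  ring

lemma IsSolutionPair.sinSol_self (x : ℝ) : sinSol u₁ u₂ x x = 0 := by
  unfold sinSol; ring

lemma IsSolutionPair.deriv_sinSol_self (hϑ : Continuous ϑ) (h : IsSolutionPair ϑ u₁ u₂) (x : ℝ) :
    deriv (sinSol u₁ u₂ x) x = 1 := by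
  have := h.wronskian_ne_zero hϑ x
  unfold sinSol
  rw [h.left.deriv_comb h.right]
  field_simp
  unfold wronskian; ring

lemma IsSolution.ext {f g : ℝ → ℝ} (hϑ : Continuous ϑ) (hf : IsSolution ϑ f)
    (hg : IsSolution ϑ g) {x : ℝ} (h₀ : f x = g x) (h₁ : deriv f x = deriv g x) : f = g := by
  funext t
  have := (hf.comb hg 1 (-1)).eq_zero hϑ (x := x) (by linarith)
    (by rw [hf.deriv_comb hg]; linarith) t
  linarith

lemma IsSolutionPair.cosSol_eq (hϑ : Continuous ϑ) (hu : IsSolutionPair ϑ u₁ u₂)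
    (hf : IsSolutionPair ϑ f₁ f₂) (x : ℝ) : cosSol u₁ u₂ x = cosSol f₁ f₂ x :=
  (hu.cosSol_isSolution x).ext hϑ (hf.cosSol_isSolution x) (x := x)
    (by rw [hu.cosSol_self hϑ, hf.cosSol_self hϑ])
    (by rw [hu.deriv_cosSol_self, hf.deriv_cosSol_self])

lemma IsSolutionPair.sinSol_eq (hϑ : Continuous ϑ) (hu : IsSolutionPair ϑ u₁ u₂)
    (hf : IsSolutionPair ϑ f₁ f₂) (x : ℝ) : sinSol u₁ u₂ x = sinSol f₁ f₂ x :=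
  (hu.sinSol_isSolution x).ext hϑ (hf.sinSol_isSolution x) (x := x)
    (by rw [sinSol_self, sinSol_self])
    (by rw [hu.deriv_sinSol_self hϑ, hf.deriv_sinSol_self hϑ])

/-- `V` does not depend on the pair of solutions from which it is computed. -/
lemma IsSolutionPair.V_congr (hϑ : Continuous ϑ) (hu : IsSolutionPair ϑ u₁ u₂)
    (hf : IsSolutionPair ϑ f₁ f₂) : V u₁ u₂ = V f₁ f₂ := by
  funext x t
  rw [V_eq, V_eq, hu.cosSol_eq hϑ hf, hu.sinSol_eq hϑ hf]

end

/-- **Sturm comparison** with `y'' + k² y = 0`, to the right of the initial point. -/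
lemma IsSolution.pos_of_le_sq {ϑ c : ℝ → ℝ} (hc : IsSolution ϑ c) {k : ℝ} (hk : 0 < k)
    (hϑ : ∀ t, ϑ t ≤ k ^ 2) {x : ℝ} (h₀ : c x = 1) (h₁ : deriv c x = 0) {t : ℝ} (hxt : x ≤ t)
    (ht : t < x + Real.pi / (2 * k)) : 0 < c t := by
  by_contra hneg
  have hcont : Continuous c := hc.1.continuous
  -- the first zero `z` of `c` after `x`
  let S : Set ℝ := Icc x t ∩ {s | c s ≤ 0}
  have hS : IsCompact S := isCompact_Icc.inter_right (isClosed_le hcont continuous_const)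
  have hSne : S.Nonempty := ⟨t, right_mem_Icc.2 hxt, not_lt.1 hneg⟩
  obtain ⟨z, hz, hmin⟩ := hS.exists_isLeast hSne
  have hpos : ∀ s ∈ Ico x z, 0 < c s := fun s hs => by
    by_contra hs0
    exact absurd (hmin ⟨⟨hs.1, hs.2.le.trans hz.1.2⟩, not_lt.1 hs0⟩) (not_le.2 hs.2)
  have hxz : x < z := lt_of_le_of_ne hz.1.1 (fun h => by
    have h2 : c z ≤ 0 := hz.2
    rw [← h, h₀] at h2; linarith)
  let y : ℝ → ℝ := fun s => Real.cos (k * (s - x))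
  have hy : ∀ s, HasDerivAt y (-Real.sin (k * (s - x)) * k) s := fun s => by
    have := (((hasDerivAt_id s).sub_const x).const_mul k).cos
    simpa using this
  have hy' : ∀ s, HasDerivAt (fun s => -Real.sin (k * (s - x)) * k)
      (-(k ^ 2 * y s)) s := fun s => by
    have := ((((hasDerivAt_id s).sub_const x).const_mul k).sin.neg).mul_const k
    exact this.congr_deriv (by simp [y]; ring)
  have hz2 : z - x < Real.pi / (2 * k) := by linarith [hz.1.2]
  have hypos : ∀ s ∈ Icc x z, 0 < y s := fun s hs => by
    apply Real.cos_pos_of_mem_Ioo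
    have h1 : 0 ≤ k * (s - x) := mul_nonneg hk.le (by linarith [hs.1])
    have h2 : k * (s - x) < Real.pi / 2 := by
      have : s - x < Real.pi / (2 * k) := by linarith [hs.2]
      calc k * (s - x) < k * (Real.pi / (2 * k)) := by gcongr
        _ = Real.pi / 2 := by field_simp
    exact ⟨by linarith [Real.pi_pos], h2⟩
  -- the Wronskian of `c` and `y` decreases from `0`, so that `y / c ≤ 1` up to `z`
  let w : ℝ → ℝ := fun s => c s * (-Real.sin (k * (s - x)) * k) - deriv c s * y s
  have hw : ∀ s, HasDerivAt w ((ϑ s - k ^ 2) * (c s * y s)) s := fun s => by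
    have := ((hc.hasDerivAt s).mul (hy' s)).sub ((hc.hasDerivAt_deriv s).mul (hy s))
    exact this.congr_deriv (by ring)
  have hwanti : AntitoneOn w (Icc x z) := by
    refine antitoneOn_of_deriv_nonpos (convex_Icc x z)
      (fun s _ => (hw s).continuousAt.continuousWithinAt)
      (fun s _ => (hw s).differentiableAt.differentiableWithinAt) fun s hs => ?_
    rw [interior_Icc] at hs
    rw [(hw s).deriv]
    exact mul_nonpos_of_nonpos_of_nonneg (by linarith [hϑ s])
      (mul_nonneg (hpos s ⟨hs.1.le, hs.2⟩).le (hypos s ⟨hs.1.le, hs.2.le⟩).le)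
  have hw0 : ∀ s ∈ Icc x z, w s ≤ 0 := fun s hs => by
    have := hwanti (left_mem_Icc.2 hxz.le) hs hs.1
    simpa [w, h₁] using this
  have hqanti : AntitoneOn (fun s => y s / c s) (Ico x z) := by
    have hd : ∀ s ∈ Ico x z, HasDerivAt (fun s => y s / c s) (w s / c s ^ 2) s := fun s hs => by
      have := (hy s).div (hc.hasDerivAt s) (hpos s hs).ne'
      exact this.congr_deriv (by simp only [w]; ring)
    refine antitoneOn_of_deriv_nonpos (convex_Ico x z)
      (fun s hs => (hd s hs).continuousAt.continuousWithinAt)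
      (fun s hs => (hd s (interior_subset hs)).differentiableAt.differentiableWithinAt)
      fun s hs => ?_
    rw [(hd s (interior_subset hs)).deriv]
    have hs' := interior_subset hs
    exact div_nonpos_of_nonpos_of_nonneg (hw0 s ⟨hs'.1, hs'.2.le⟩) (sq_nonneg _)
  have hle : ∀ s ∈ Ico x z, y s ≤ c s := fun s hs => by
    have := hqanti (left_mem_Ico.2 hxz) hs hs.1
    have hx1 : y x / c x = 1 := by simp [y, h₀]
    simp only [hx1] at this
    exact (div_le_one (hpos s hs)).1 this
  have hlim : y z ≤ c z := by
    have hycont : Continuous y := continuous_iff_continuousAt.2 fun s => (hy s).continuousAt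
    refine le_of_tendsto_of_tendsto (b := 𝓝[<] z) (hycont.tendsto z |>.mono_left nhdsWithin_le_nhds)
      (hcont.tendsto z |>.mono_left nhdsWithin_le_nhds) ?_
    filter_upwards [Ico_mem_nhdsLT hxz] with s hs using hle s hs
  have := hypos z (right_mem_Icc.2 hxz.le)
  have h3 : c z ≤ 0 := hz.2
  linarith

/-- **Sturm comparison**: if `ϑ ≤ k²`, a solution with a critical point at `x` and value `1` there
does not vanish at distance less than `π / (2 k)` from `x`. -/
lemma IsSolution.ne_zero_of_le_sq {ϑ c : ℝ → ℝ} (hc : IsSolution ϑ c) {k : ℝ} (hk : 0 < k)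
    (hϑ : ∀ t, ϑ t ≤ k ^ 2) {x : ℝ} (h₀ : c x = 1) (h₁ : deriv c x = 0) {t : ℝ}
    (ht : |t - x| < Real.pi / (2 * k)) : c t ≠ 0 := by
  have h2 := abs_lt.1 ht
  rcases le_total x t with h | h
  · exact (hc.pos_of_le_sq hk hϑ h₀ h₁ h (by linarith)).ne'
  · have := hc.comp_neg.pos_of_le_sq (x := -x) (t := -t) hk (fun s => hϑ _) (by simpa)
      (by rw [deriv_comp_neg]; simpa) (by linarith) (by linarith)
    simpa using this.ne'

/-! ### Measures with prescribed moments -/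

/-- Helly's selection principle for moments: limits of moments of measures with densities on a
fixed compact interval are moments of a measure. -/
lemma exists_measure_of_tendsto_moments {B : ℝ} (hB : 0 < B) {d : ℕ → ℝ → ℝ}
    (hd : ∀ k, Continuous (d k)) (hd0 : ∀ k t, 0 ≤ d k t) {a : ℕ → ℝ}
    (hlim : ∀ n, Tendsto (fun k => ∫ t in (-B)..B, t ^ n * d k t) atTop (𝓝 (a n))) :
    ∃ μ : Measure ℝ, ∀ n : ℕ, Integrable (fun t : ℝ => t ^ n) μ ∧ ∫ t, t ^ n ∂μ = a n := by
  have hBB : -B ≤ B := by linarith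
  let K : Set ℝ := Icc (-B) B
  let m : ℕ → Measure ℝ := fun k =>
    (volume.restrict K).withDensity fun t => ENNReal.ofReal (d k t)
  have hint : ∀ k (f : ℝ → ℝ), ∫ t, f t ∂(m k) = ∫ t in (-B)..B, f t * d k t := by
    intro k f
    rw [integral_withDensity_eq_integral_toReal_smul (hd k).measurable.ennreal_ofReal (by simp),
      intervalIntegral.integral_of_le hBB, ← integral_Icc_eq_integral_Ioc]
    refine integral_congr_ae (Eventually.of_forall fun t => ?_)
    simp only [ENNReal.toReal_ofReal (hd0 k t), smul_eq_mul, mul_comm]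
  have hfin : ∀ k, IsFiniteMeasure (m k) := fun k =>
    isFiniteMeasure_withDensity_ofReal
      ((hd k).continuousOn.integrableOn_compact isCompact_Icc).2
  let P : ℕ → FiniteMeasure ℝ := fun k => ⟨m k, hfin k⟩
  have hmass : ∀ k, ((P k).mass : ℝ) = ∫ t in (-B)..B, t ^ 0 * d k t := fun k => by
    have h1 := hint k (fun t => t ^ 0)
    rw [← h1]
    simp [FiniteMeasure.mass, P, Measure.real]
    rfl
  obtain ⟨C, hC⟩ := (hlim 0).bddAbove_range
  have hsupp : ∀ k, m k Kᶜ = 0 := fun k =>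
    withDensity_absolutelyContinuous _ _ (by simp [K])
  have hcomp := isCompact_setOfPred_finiteMeasure_le_of_isCompact (E := ℝ) (Real.toNNReal C)
    (isCompact_Icc : IsCompact K)
  obtain ⟨μ, ⟨-, hμK⟩, hμ⟩ := hcomp.ultrafilter_le_nhds ((hyperfilter ℕ).map P) (by
    rw [Ultrafilter.coe_map, le_principal_iff, mem_map]
    refine Eventually.of_forall fun k => ⟨?_, ?_⟩
    · rw [← NNReal.coe_le_coe, hmass k]
      exact (hC ⟨k, rfl⟩).trans (Real.le_coe_toNNReal C)
    · rw [FiniteMeasure.null_iff_toMeasure_null]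
      exact hsupp k)
  have hμK' : (μ : Measure ℝ) Kᶜ = 0 := (FiniteMeasure.null_iff_toMeasure_null _ _).1 hμK
  have hae : ∀ ν : Measure ℝ, ν Kᶜ = 0 → ∀ᵐ t ∂ν, max (-B) (min B t) = t := fun ν hν => by
    filter_upwards [show K ∈ ae ν from hν] with t ht
    rw [min_eq_right ht.2, max_eq_right ht.1]
  refine ⟨μ, fun n => ?_⟩
  -- on `[-B, B]` the monomial agrees with a bounded continuous function
  have hbd : ∀ t : ℝ, ‖max (-B) (min B t) ^ n‖ ≤ B ^ n := fun t => by
    rw [norm_pow]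
    refine pow_le_pow_left₀ (norm_nonneg _) (abs_le.2 ⟨le_max_left _ _, ?_⟩) n
    exact max_le hBB (min_le_left _ _)
  let g : BoundedContinuousFunction ℝ ℝ := BoundedContinuousFunction.ofNormedAddCommGroup
    (fun t : ℝ => max (-B) (min B t) ^ n) (by fun_prop) (B ^ n) hbd
  have hg : ∀ ν : Measure ℝ, ν Kᶜ = 0 → (fun t => g t) =ᵐ[ν] fun t => t ^ n := fun ν hν => by
    filter_upwards [hae ν hν] with t ht
    change max (-B) (min B t) ^ n = t ^ n
    rw [ht]
  have h1 : Tendsto (fun k => ∫ t, g t ∂(m k)) (hyperfilter ℕ) (𝓝 (∫ t, g t ∂(μ : Measure ℝ))) :=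
    FiniteMeasure.tendsto_iff_forall_integral_tendsto.1 hμ g
  have h2 : ∀ k, ∫ t, g t ∂(m k) = ∫ t in (-B)..B, t ^ n * d k t := fun k => by
    rw [integral_congr_ae (hg _ (hsupp k)), hint]
  simp only [h2, integral_congr_ae (hg _ hμK')] at h1
  refine ⟨(g.integrable _).congr (hg _ hμK'), ?_⟩
  exact tendsto_nhds_unique h1 ((hlim n).mono_left (Nat.hyperfilter_le_atTop))

/-! ### Taylor expansions of holomorphic functions -/

/-- Taylor's formula of order `N` at `0` with a holomorphic remainder `w ^ N * e w`, where `e` is the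
`N`-fold difference quotient. -/
lemma exists_taylor_remainder {φ : ℂ → ℂ} {ρ : ℝ} (hρ : 0 < ρ)
    (hφ : DifferentiableOn ℂ φ (ball 0 ρ)) (N : ℕ) :
    ∃ e : ℂ → ℂ, DifferentiableOn ℂ e (ball 0 ρ) ∧
      e 0 = iteratedDeriv N φ 0 / N.factorial ∧
      ∀ w, φ w = (∑ k ∈ Finset.range N, iteratedDeriv k φ 0 / k.factorial * w ^ k) +
        w ^ N * e w := by
  have hp := (hφ.analyticAt (ball_mem_nhds 0 hρ)).hasFPowerSeriesAt
  have h0 : ∀ n, (Function.swap dslope 0)^[n] φ 0 = iteratedDeriv n φ 0 / n.factorial := fun n => by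
    rw [← (hp.has_fpower_series_iterate_dslope_fslope n).coeff_zero 1,
      ← FormalMultilinearSeries.coeff, FormalMultilinearSeries.coeff_iterate_fslope]
    simp
  refine ⟨(Function.swap dslope 0)^[N] φ, ?_, h0 N, ?_⟩
  · clear h0 hp
    induction N with
    | zero => simpa using hφ
    | succ N ih =>
      rw [Function.iterate_succ_apply']
      exact (Complex.differentiableOn_dslope (ball_mem_nhds 0 hρ)).2 ih
  · intro w
    induction N with
    | zero => simp
    | succ N ih =>
      rw [ih, Finset.sum_range_succ, add_assoc, ← h0 N, Function.iterate_succ_apply']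
      congr 1
      have := sub_smul_dslope ((Function.swap dslope 0)^[N] φ) 0 w
      simp only [sub_zero, smul_eq_mul] at this
      change _ = _ + w ^ (N + 1) * dslope ((Function.swap dslope 0)^[N] φ) 0 w
      rw [pow_succ, mul_assoc, this]
      ring

/-- The derivatives on the real axis of a holomorphic function extending `g` are those of `g`. -/
lemma iteratedDeriv_ofReal_eq {φ : ℂ → ℂ} {g : ℝ → ℝ} {ρ : ℝ}
    (hφ : DifferentiableOn ℂ φ (ball 0 ρ)) (hg : ∀ t : ℝ, |t| < ρ → φ t = g t) (n : ℕ) :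
    ∀ t : ℝ, |t| < ρ → iteratedDeriv n φ t = iteratedDeriv n g t := by
  induction n with
  | zero => simpa using hg
  | succ n ih =>
    intro t ht
    have hdiff : DifferentiableAt ℂ (iteratedDeriv n φ) t := by
      have hmem : (t : ℂ) ∈ ball (0 : ℂ) ρ := by simpa using ht
      have hA : AnalyticAt ℂ φ t := hφ.analyticAt (isOpen_ball.mem_nhds hmem)
      rw [iteratedDeriv_eq_iterate]
      exact (hA.iterated_deriv n).differentiableAt
    have hev : ∀ᶠ s : ℝ in 𝓝 t, iteratedDeriv n φ s = iteratedDeriv n g s := by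
      have : ∀ᶠ s : ℝ in 𝓝 t, |s| < ρ := continuous_abs.continuousAt.eventually_lt_const ht
      filter_upwards [this] with s hs using ih s hs
    rw [iteratedDeriv_succ, iteratedDeriv_succ]
    have h1 : HasDerivAt (fun s : ℝ => iteratedDeriv n φ s) (deriv (iteratedDeriv n φ) t) t :=
      hdiff.hasDerivAt.comp_ofReal
    have h2 : HasDerivAt (fun s : ℝ => ((iteratedDeriv n g s : ℝ) : ℂ))
        (deriv (iteratedDeriv n φ) t) t := h1.congr_of_eventuallyEq (hev.mono fun s hs => hs.symm)
    have h3 : HasDerivAt (iteratedDeriv n g) (deriv (iteratedDeriv n φ) t).re t := by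
      exact Complex.reCLM.hasFDerivAt.comp_hasDerivAt t h2
    have h4 := h3.ofReal_comp.unique h2
    rw [h3.deriv, h4]

/-! ### The moments of a Pick function analytic at the origin -/

/-- The integral of `f` from `-B` to `B` along the three lower sides of the rectangle
`[-B, B] × [-B, 0]`. -/
noncomputable def lowerPath (B : ℝ) (f : ℂ → ℂ) : ℂ :=
  (∫ x : ℝ in (-B)..B, f (x + -B * I)) + (I * ∫ y : ℝ in (-B)..0, f (B + y * I)) -
    I * ∫ y : ℝ in (-B)..0, f (-B + y * I)

lemma integral_eq_lowerPath {B : ℝ} {f : ℂ → ℂ} (hf : ∀ ζ : ℂ, ζ.im ≤ 0 → DifferentiableAt ℂ f ζ)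
    (hB : 0 < B) : ∫ x : ℝ in (-B)..B, f x = lowerPath B f := by
  have h := integral_boundary_rect_eq_zero_of_differentiableOn f (-B + -B * I) B (by
    intro ζ hζ
    refine (hf ζ ?_).differentiableWithinAt
    have := hζ.2
    simp only [mem_preimage, uIcc_of_le (show ((-B : ℂ) + -B * I).im ≤ (B : ℂ).im by simp [hB.le])]
      at this
    simpa using this.2)
  simp at h
  simp only [lowerPath, neg_mul]
  linear_combination -h

lemma le_norm_of_mem_sides {B : ℝ} (hB : 0 < B) {ζ : ℂ} (h : ζ.re = B ∨ ζ.re = -B ∨ ζ.im = -B) :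
    B ≤ ‖ζ‖ := by
  rcases h with h | h | h
  · exact (le_abs_self _).trans (h ▸ abs_re_le_norm ζ)
  · have := abs_re_le_norm ζ
    rw [h, abs_neg, abs_of_pos hB] at this; exact this
  · have := abs_im_le_norm ζ
    rw [h, abs_neg, abs_of_pos hB] at this; exact this

lemma lowerPath_eq_sub {B : ℝ} (hB : 0 < B) {f P : ℂ → ℂ}
    (hf : ∀ ζ : ℂ, ζ.im ≤ 0 → B ≤ ‖ζ‖ → ContinuousAt f ζ)
    (hP : ∀ ζ : ℂ, ζ.im ≤ 0 → B ≤ ‖ζ‖ → HasDerivAt P (f ζ) ζ) :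
    lowerPath B f = P B - P (-B) := by
  have hside : ∀ b : ℝ, (b = B ∨ b = -B) →
      I * ∫ y : ℝ in (-B)..0, f (b + y * I) = P b - P (b + -B * I) := by
    intro b hb
    have hQ : ∀ y ∈ uIcc (-B) 0, ((b : ℂ) + y * I).im ≤ 0 ∧ B ≤ ‖(b : ℂ) + y * I‖ := by
      intro y hy
      rw [uIcc_of_le (by linarith)] at hy
      refine ⟨by simpa using hy.2, le_norm_of_mem_sides hB ?_⟩
      rcases hb with rfl | rfl <;> simp
    rw [← intervalIntegral.integral_const_mul]
    rw [intervalIntegral.integral_eq_sub_of_hasDerivAt (f := fun y : ℝ => P (b + y * I))]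
    · simp
    · intro y hy
      have h1 := hP _ (hQ y hy).1 (hQ y hy).2
      have h2 : HasDerivAt (fun z : ℂ => (b : ℂ) + z * I) I (y : ℂ) := by
        simpa using ((hasDerivAt_id (y : ℂ)).mul_const I).const_add (b : ℂ)
      exact ((h1.comp (y : ℂ) h2).comp_ofReal).congr_deriv (mul_comm _ _)
    · refine ContinuousOn.intervalIntegrable fun y hy => ?_
      have h1 := hf _ (hQ y hy).1 (hQ y hy).2
      have h2 : ContinuousAt (fun y : ℝ => (b : ℂ) + y * I) y := by fun_prop
      exact (continuousAt_const.mul (ContinuousAt.comp (f := fun y : ℝ => (b : ℂ) + y * I)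
        h1 h2)).continuousWithinAt
  have hbot : ∫ x : ℝ in (-B)..B, f (x + -B * I) = P (B + -B * I) - P (-B + -B * I) := by
    have hQ : ∀ x : ℝ, ((x : ℂ) + -B * I).im ≤ 0 ∧ B ≤ ‖(x : ℂ) + -B * I‖ := fun x =>
      ⟨by simpa using hB.le, le_norm_of_mem_sides hB (by simp)⟩
    rw [intervalIntegral.integral_eq_sub_of_hasDerivAt (f := fun x : ℝ => P (x + -B * I))]
    · simp
    · intro x _
      have h1 := hP _ (hQ x).1 (hQ x).2
      have h2 : HasDerivAt (fun z : ℂ => z + -B * I) 1 (x : ℂ) :=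
        (hasDerivAt_id (x : ℂ)).add_const _
      exact ((h1.comp (x : ℂ) h2).comp_ofReal).congr_deriv (mul_one _)
    · refine ContinuousOn.intervalIntegrable fun x _ => ?_
      have h2 : ContinuousAt (fun x : ℝ => (x : ℂ) + -B * I) x := by fun_prop
      exact (ContinuousAt.comp (f := fun x : ℝ => (x : ℂ) + -B * I)
        (hf _ (hQ x).1 (hQ x).2) h2).continuousWithinAt
  have h1 := hside B (Or.inl rfl)
  have h2 := hside (-B) (Or.inr rfl)
  unfold lowerPath
  push_cast at h2
  rw [h1, h2, hbot]
  ring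

/-- The shift by `-iε` keeps the three lower sides in the closed set on which `G` is continuous. -/
lemma tendsto_lowerPath {B : ℝ} (hB : 0 < B) {G : ℂ → ℂ} (n : ℕ)
    (hG : ∀ ζ : ℂ, ζ.im ≤ 0 → B ≤ ‖ζ‖ → ContinuousAt G ζ) :
    Tendsto (fun ε : ℝ => lowerPath B fun ζ => ζ ^ n * G (ζ - ε * I)) (𝓝[>] 0)
      (𝓝 (lowerPath B fun ζ => ζ ^ n * G ζ)) := by
  let Q : Set ℂ := {ζ | ζ.im ≤ 0 ∧ B ≤ ‖ζ‖}
  have hGQ : ContinuousOn G Q := fun ζ hζ => (hG ζ hζ.1 hζ.2).continuousWithinAt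
  -- truncations make the integrands continuous for all values of the parameters
  have key : ∀ (γ : ℝ → ℂ) (a b : ℝ), Continuous γ →
      (∀ y, (γ y).im ≤ 0 ∧ ((γ y).re = B ∨ (γ y).re = -B ∨ (γ y).im ≤ -B)) →
      Tendsto (fun ε : ℝ => ∫ y in a..b, γ y ^ n * G (γ y - ε * I)) (𝓝[>] 0)
        (𝓝 (∫ y in a..b, γ y ^ n * G (γ y))) := by
    intro γ a b hγ hγQ
    have hmem : ∀ p : ℝ × ℝ, γ p.2 - (max p.1 0 : ℝ) * I ∈ Q := fun p => by
      have h0 : 0 ≤ max p.1 0 := le_max_right _ _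
      have h1 := hγQ p.2
      refine ⟨by simp only [sub_im, mul_im, ofReal_re, ofReal_im, I_re, I_im]; linarith [h1.1], ?_⟩
      rcases h1.2 with h | h | h
      · exact le_norm_of_mem_sides hB (by left; simpa using h)
      · exact le_norm_of_mem_sides hB (by right; left; simpa using h)
      · have := abs_im_le_norm (γ p.2 - (max p.1 0 : ℝ) * I)
        refine le_trans ?_ this
        rw [le_abs]
        right
        simp only [sub_im, mul_im, ofReal_re, ofReal_im, I_re, I_im]; linarith
    have hcont : Continuous (Function.uncurry fun ε y : ℝ =>
        γ y ^ n * G (γ y - (max ε 0 : ℝ) * I)) := by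
      refine Continuous.mul (by fun_prop) (hGQ.comp_continuous (by fun_prop) hmem)
    have h := (intervalIntegral.continuous_parametric_intervalIntegral_of_continuous'
      (μ := volume) hcont a b).tendsto 0
    simp only [max_self, ofReal_zero, zero_mul, sub_zero] at h
    refine (h.mono_left nhdsWithin_le_nhds).congr' ?_
    filter_upwards [self_mem_nhdsWithin] with ε hε
    rw [max_eq_left (le_of_lt hε)]
  have hside : ∀ b : ℝ, (b = B ∨ b = -B) →
      Tendsto (fun ε : ℝ => ∫ y : ℝ in (-B)..0, ((b : ℂ) + y * I) ^ n * G (b + y * I - ε * I))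
        (𝓝[>] 0) (𝓝 (∫ y : ℝ in (-B)..0, ((b : ℂ) + y * I) ^ n * G (b + y * I))) := by
    intro b hb
    have h := key (fun y => (b : ℂ) + (min y 0 : ℝ) * I) (-B) 0 (by fun_prop) (fun y => by
      refine ⟨by simp, ?_⟩
      rcases hb with rfl | rfl <;> simp)
    have hmin : ∀ y ∈ uIcc (-B) 0, min y 0 = y := fun y hy => by
      rw [uIcc_of_le (by linarith)] at hy
      exact min_eq_left hy.2
    rw [intervalIntegral.integral_congr
      (g := fun y : ℝ => ((b : ℂ) + y * I) ^ n * G (b + y * I))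
      (fun y hy => by simp only [hmin y hy])] at h
    refine h.congr fun ε => intervalIntegral.integral_congr fun y hy => ?_
    simp only [hmin y hy]
  have hbot := key (fun x => (x : ℂ) + -B * I) (-B) B (by fun_prop) (fun x => by
    simpa using hB.le)
  have h1 := hside B (Or.inl rfl)
  have h2 := hside (-B) (Or.inr rfl)
  simp only [ofReal_neg] at h2
  exact (hbot.add (h1.const_mul I)).sub (h2.const_mul I)

lemma im_log_I_mul_sub {B : ℝ} (hB : 0 < B) :
    (Complex.log (I * B)).im - (Complex.log (I * (-B))).im = Real.pi := by
  have h1 : I * (B : ℂ) = (B : ℂ) * I := mul_comm _ _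
  have h2 : I * (-(B : ℂ)) = (B : ℂ) * (-I) := by ring
  rw [log_im, log_im, h1, h2, arg_real_mul _ hB, arg_real_mul _ hB, arg_I, arg_neg_I]
  ring

/-- A primitive of a function that is real on the real axis has constant imaginary part there. -/
lemma im_primitive_eq {e Φ : ℂ → ℂ} {ρ : ℝ} (hΦ : ∀ w ∈ ball (0 : ℂ) ρ, HasDerivAt Φ (e w) w)
    (he : ∀ t : ℝ, |t| < ρ → (e t).im = 0) {s t : ℝ} (hs : |s| < ρ) (ht : |t| < ρ) :
    (Φ s).im = (Φ t).im := by
  have hd : ∀ r ∈ Ioo (-ρ) ρ, HasDerivAt (fun r : ℝ => (Φ r).im) 0 r := fun r hr => by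
    have hr' : |r| < ρ := abs_lt.2 hr
    have h1 := (hΦ r (by simpa using hr')).comp_ofReal
    have h2 : HasDerivAt (fun r : ℝ => (Φ r).im) (e r).im r :=
      Complex.imCLM.hasFDerivAt.comp_hasDerivAt r h1
    rwa [he r hr'] at h2
  exact isOpen_Ioo.is_const_of_deriv_eq_zero isPreconnected_Ioo
    (fun r hr => (hd r hr).differentiableAt.differentiableWithinAt)
    (fun r hr => (hd r hr).deriv) (abs_lt.1 hs) (abs_lt.1 ht)

/-- Up to the factor `π`, the `n`-th moment of the measure is a Taylor coefficient: apart from the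
term `c / ζ`, which contributes the increment of a logarithm, the function `ζ ^ n φ(1 / ζ)` has a
primitive outside a disc that is real on the real axis. -/
lemma im_lowerPath {φ : ℂ → ℂ} {g : ℝ → ℝ} {ρ B : ℝ} (hρ : 0 < ρ) (hB : 1 / ρ < B)
    (hφ : DifferentiableOn ℂ φ (ball 0 ρ)) (hg : ∀ t : ℝ, |t| < ρ → φ t = g t) (n : ℕ) :
    (lowerPath B fun ζ => ζ ^ n * φ ζ⁻¹).im =
      Real.pi * (iteratedDeriv (n + 1) g 0 / (n + 1).factorial) := by
  have hB0 : 0 < B := (by positivity : 0 < 1 / ρ).trans hB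
  obtain ⟨e, hed, he0, he⟩ := exists_taylor_remainder hρ hφ (n + 2)
  let c : ℕ → ℝ := fun k => iteratedDeriv k g 0 / k.factorial
  have hc : ∀ k, iteratedDeriv k φ 0 / k.factorial = c k := fun k => by
    have := iteratedDeriv_ofReal_eq hφ hg k 0 (by simpa using hρ)
    simp only [ofReal_zero] at this
    simp [c, this]
  simp only [hc] at he0 he
  have hereal : ∀ t : ℝ, |t| < ρ → (e t).im = 0 := by
    intro t ht
    rcases eq_or_ne t 0 with rfl | h0
    · simp [he0]
    · have h1 := he t
      rw [hg t ht] at h1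
      have h2 : e t = (((g t - ∑ k ∈ Finset.range (n + 2), c k * t ^ k) / t ^ (n + 2) : ℝ) : ℂ) := by
        push_cast
        rw [eq_div_iff (pow_ne_zero _ (by exact_mod_cast h0)), h1]
        ring
      rw [h2, ofReal_im]
  obtain ⟨Φ, hΦ⟩ := hed.isExactOn_ball
  let P : ℂ → ℂ := fun ζ => (∑ k ∈ Finset.range (n + 1),
    (c k / (n - k + 1 : ℕ) : ℝ) * ζ ^ (n - k + 1)) + c (n + 1) * Complex.log (I * ζ) - Φ ζ⁻¹
  have hinv : ∀ ζ : ℂ, B ≤ ‖ζ‖ → ζ⁻¹ ∈ ball (0 : ℂ) ρ := fun ζ hζ => by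
    rw [mem_ball_zero_iff, norm_inv]
    have h1 : 1 / ρ < ‖ζ‖ := hB.trans_le hζ
    exact inv_lt_of_inv_lt₀ hρ (by simpa using h1)
  have hne : ∀ ζ : ℂ, B ≤ ‖ζ‖ → ζ ≠ 0 := fun ζ hζ => norm_pos_iff.1 (hB0.trans_le hζ)
  have hlow : lowerPath B (fun ζ => ζ ^ n * φ ζ⁻¹) = P B - P (-B) := by
    refine lowerPath_eq_sub hB0 (fun ζ _ hζ => ?_) fun ζ him hζ => ?_
    · have h1 := (hφ.differentiableAt (isOpen_ball.mem_nhds (hinv ζ hζ))).continuousAt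
      exact (continuousAt_id.pow n).mul
        (ContinuousAt.comp (f := fun ζ : ℂ => ζ⁻¹) h1 (continuousAt_inv₀ (hne ζ hζ)))
    · have hζ0 := hne ζ hζ
      -- rotated by `I`, the closed lower half-plane avoids the cut of the logarithm
      have hslit : I * ζ ∈ slitPlane := by
        rw [mem_slitPlane_iff]
        rcases him.lt_or_eq with h | h
        · left; simpa using h
        · right
          simp only [mul_im, I_re, I_im, zero_mul, one_mul, zero_add]
          intro hre
          exact hζ0 (Complex.ext hre h)
      have d1 : HasDerivAt (fun ζ : ℂ => ∑ k ∈ Finset.range (n + 1),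
          (c k / (n - k + 1 : ℕ) : ℝ) * ζ ^ (n - k + 1))
          (∑ k ∈ Finset.range (n + 1), (c k : ℂ) * ζ ^ (n - k)) ζ := by
        refine HasDerivAt.fun_sum fun k _ => ?_
        refine ((hasDerivAt_pow (n - k + 1) ζ).const_mul _).congr_deriv ?_
        have : ((n - k + 1 : ℕ) : ℂ) ≠ 0 := Nat.cast_ne_zero.2 (Nat.succ_ne_zero _)
        rw [ofReal_div, ofReal_natCast]
        field_simp
        simp
      have d2 : HasDerivAt (fun ζ : ℂ => (c (n + 1) : ℂ) * Complex.log (I * ζ))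
          (c (n + 1) * ζ⁻¹) ζ := by
        have h1 : HasDerivAt (fun ζ : ℂ => I * ζ) I ζ := by
          simpa using (hasDerivAt_id ζ).const_mul I
        refine ((h1.clog hslit).const_mul _).congr_deriv ?_
        field_simp
      have d3 : HasDerivAt (fun ζ : ℂ => Φ ζ⁻¹) (e ζ⁻¹ * (-(ζ ^ 2)⁻¹)) ζ :=
        (hΦ _ (hinv ζ hζ)).comp ζ (hasDerivAt_inv hζ0)
      refine ((d1.add d2).sub d3).congr_deriv ?_
      rw [he, Finset.sum_range_succ _ (n + 1), mul_add, mul_add, Finset.mul_sum]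
      have h1 : ∀ k ∈ Finset.range (n + 1), ζ ^ n * (c k * ζ⁻¹ ^ k) = c k * ζ ^ (n - k) := by
        intro k hk
        have hk' : k ≤ n := Nat.lt_succ_iff.1 (Finset.mem_range.1 hk)
        obtain ⟨m, rfl⟩ := Nat.exists_eq_add_of_le hk'
        rw [Nat.add_sub_cancel_left, pow_add, inv_pow]
        field_simp
      rw [Finset.sum_congr rfl h1, inv_pow, inv_pow]
      field_simp
      ring
  have hreal : ∀ b : ℝ, (P b).im =
      c (n + 1) * (Complex.log (I * b)).im - (Φ ((b⁻¹ : ℝ) : ℂ)).im := fun b => by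
    have : (∑ k ∈ Finset.range (n + 1), ((c k / (n - k + 1 : ℕ) : ℝ) : ℂ) * (b : ℂ) ^ (n - k + 1))
        = ((∑ k ∈ Finset.range (n + 1), (c k / (n - k + 1 : ℕ)) * b ^ (n - k + 1) : ℝ) : ℂ) := by
      push_cast; rfl
    simp only [P]
    rw [this, sub_im, add_im, ofReal_im, im_ofReal_mul, ofReal_inv, zero_add]
  have h1 := hreal B
  have h2 := hreal (-B)
  rw [ofReal_neg] at h2
  have habs : |B⁻¹| < ρ := by
    rw [abs_of_pos (inv_pos.2 hB0)]
    exact inv_lt_of_inv_lt₀ hρ (by simpa using hB)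
  have h3 : (Φ ((B⁻¹ : ℝ) : ℂ)).im = (Φ (((-B)⁻¹ : ℝ) : ℂ)).im :=
    im_primitive_eq hΦ hereal habs (by rwa [inv_neg, abs_neg])
  rw [hlow, sub_im, h1, h2, h3, ← im_log_I_mul_sub hB0]
  ring

/-- The Taylor coefficients at `0` of a Pick function that is holomorphic and real near `0` are the
moments of a measure. -/
lemma exists_measure_of_pick {φ : ℂ → ℂ} {g : ℝ → ℝ} {ρ : ℝ} (hρ : 0 < ρ)
    (hφ : DifferentiableOn ℂ φ (ball 0 ρ)) (hg : ∀ t : ℝ, |t| < ρ → φ t = g t)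
    (hup : ∀ w : ℂ, 0 < w.im → DifferentiableAt ℂ φ w)
    (hpos : ∀ w : ℂ, 0 < w.im → 0 ≤ (φ w).im) :
    ∃ μ : Measure ℝ, ∀ n : ℕ, Integrable (fun t : ℝ => t ^ n) μ ∧
      ∫ t, t ^ n ∂μ = iteratedDeriv (n + 1) g 0 / (n + 1).factorial := by
  -- any `B > 1 / ρ` does: the sides of the rectangle are then inverted into the disc
  let B : ℝ := 1 / ρ + 1
  have hB : 1 / ρ < B := by simp [B]
  have hB0 : 0 < B := (by positivity : 0 < 1 / ρ).trans hB
  have hinvim : ∀ ζ : ℂ, ζ.im < 0 → 0 < (ζ⁻¹).im := fun ζ h => by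
    rw [inv_im]
    have : 0 < normSq ζ := normSq_pos.2 (fun h0 => by simp [h0] at h)
    exact div_pos (by linarith) this
  have hGlow : ∀ ζ : ℂ, ζ.im < 0 → DifferentiableAt ℂ (fun ζ => φ ζ⁻¹) ζ := fun ζ h =>
    DifferentiableAt.comp ζ (hup _ (hinvim ζ h))
      (differentiableAt_inv (fun h0 => by simp [h0] at h))
  have hGout : ∀ ζ : ℂ, B ≤ ‖ζ‖ → ContinuousAt (fun ζ => φ ζ⁻¹) ζ := fun ζ h => by
    have hmem : ζ⁻¹ ∈ ball (0 : ℂ) ρ := by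
      rw [mem_ball_zero_iff, norm_inv]
      exact inv_lt_of_inv_lt₀ hρ (by simpa using hB.trans_le h)
    have h1 := (hφ.differentiableAt (isOpen_ball.mem_nhds hmem)).continuousAt
    exact ContinuousAt.comp (f := fun ζ : ℂ => ζ⁻¹) h1
      (continuousAt_inv₀ (norm_pos_iff.1 (hB0.trans_le h)))
  have hlim := fun n => tendsto_lowerPath hB0 n (fun ζ _ h => hGout ζ h)
  let ε : ℕ → ℝ := fun k => 1 / ((k : ℝ) + 1)
  have hε0 : ∀ k, 0 < ε k := fun k => by positivity
  have hε : Tendsto ε atTop (𝓝[>] 0) :=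
    tendsto_nhdsWithin_iff.2 ⟨tendsto_one_div_add_atTop_nhds_zero_nat,
      Eventually.of_forall hε0⟩
  have him : ∀ k (ζ : ℂ), ζ.im ≤ 0 → (ζ - ε k * I).im < 0 := fun k ζ h => by
    have := hε0 k
    simp only [sub_im, mul_im, ofReal_re, ofReal_im, I_re, I_im]; linarith
  have hcont : ∀ k, Continuous fun t : ℝ => φ ((t : ℂ) - ε k * I)⁻¹ := fun k =>
    continuous_iff_continuousAt.2 fun t =>
      ContinuousAt.comp (f := fun t : ℝ => (t : ℂ) - ε k * I)
        (hGlow _ (him k t (by simp))).continuousAt (by fun_prop)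
  have hpath : ∀ k n, ∫ t in (-B)..B, t ^ n * ((φ ((t : ℂ) - ε k * I)⁻¹).im / Real.pi) =
      (lowerPath B fun ζ => ζ ^ n * φ (ζ - ε k * I)⁻¹).im / Real.pi := fun k n => by
    rw [← integral_eq_lowerPath (fun ζ hζ => ?_) hB0]
    · have h1 := Complex.imCLM.intervalIntegral_comp_comm (μ := volume) (a := -B) (b := B)
        (f := fun t : ℝ => (t : ℂ) ^ n * φ ((t : ℂ) - ε k * I)⁻¹)
        ((Continuous.mul (by fun_prop) (hcont k)).intervalIntegrable _ _)
      simp only [imCLM_apply] at h1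
      rw [← h1, ← intervalIntegral.integral_div]
      refine intervalIntegral.integral_congr fun t _ => ?_
      simp only [← ofReal_pow, im_ofReal_mul]
      ring
    · refine (differentiableAt_id.pow n).mul ?_
      exact DifferentiableAt.comp (f := fun ζ : ℂ => ζ - ε k * I) ζ (hGlow _ (him k ζ hζ))
        (by fun_prop)
  refine exists_measure_of_tendsto_moments hB0
    (d := fun k t => (φ ((t : ℂ) - ε k * I)⁻¹).im / Real.pi)
    (fun k => (continuous_im.comp (hcont k)).div_const _)
    (fun k t => div_nonneg (hpos _ (hinvim _ (him k t (by simp)))) Real.pi_pos.le) fun n => ?_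
  simp only [hpath]
  have h1 := ((continuous_im.tendsto _).comp ((hlim n).comp hε)).div_const Real.pi
  rw [im_lowerPath hρ hB hφ hg n, mul_div_cancel_left₀ _ Real.pi_ne_zero] at h1
  exact h1

/-- Moments bounded as the Taylor coefficients of a function holomorphic in a disc of radius `ρ`
force the support into `[-1/ρ, 1/ρ]`. -/
lemma support_subset_of_moments {φ : ℂ → ℂ} {g : ℝ → ℝ} {ρ : ℝ} (hρ : 0 < ρ)
    (hφ : DifferentiableOn ℂ φ (ball 0 ρ)) (hg : ∀ t : ℝ, |t| < ρ → φ t = g t)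
    {μ : Measure ℝ} (hμ : ∀ n : ℕ, Integrable (fun t : ℝ => t ^ n) μ ∧
      ∫ t, t ^ n ∂μ = iteratedDeriv (n + 1) g 0 / (n + 1).factorial) :
    μ.support ⊆ Icc (-(1 / ρ)) (1 / ρ) := by
  have hfin : IsFiniteMeasure μ := by
    have := (hμ 0).1
    simp only [pow_zero] at this
    exact (integrable_const_iff_isFiniteMeasure one_ne_zero).1 this
  -- mass at distance at least `a > 1 / r` from the origin vanishes, for every `r < ρ`
  have key : ∀ r a : ℝ, 0 < r → r < ρ → 1 < r * a → μ {t | a ≤ |t|} = 0 := by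
    intro r a hr hrρ hra
    have ha : 0 < a := by
      by_contra h
      nlinarith [mul_nonpos_of_nonneg_of_nonpos hr.le (not_lt.1 h)]
    have hsub : closedBall (0 : ℂ) r ⊆ ball 0 ρ := closedBall_subset_ball hrρ
    obtain ⟨C, hC⟩ := (isCompact_sphere (0 : ℂ) r).exists_bound_of_continuousOn
      (hφ.continuousOn.mono (sphere_subset_closedBall.trans hsub))
    have hcauchy : ∀ n, |iteratedDeriv n g 0 / n.factorial| ≤ C / r ^ n := fun n => by
      have h1 := norm_iteratedDeriv_le_of_forall_mem_sphere_norm_le n hr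
        ((hφ.mono hsub).diffContOnCl_ball le_rfl |>.mono (subset_refl _)) hC
      have h2 := iteratedDeriv_ofReal_eq hφ hg n 0 (by simpa using hρ)
      rw [ofReal_zero] at h2
      rw [h2, norm_real, Real.norm_eq_abs] at h1
      rw [abs_div, Nat.abs_cast, div_le_iff₀ (by positivity)]
      calc _ ≤ _ := h1
        _ = _ := by ring
    have hmark : ∀ n : ℕ, μ.real {t | a ≤ |t|} ≤ C / r * ((1 / (r * a)) ^ 2) ^ n := fun n => by
      have hsq : ∀ t : ℝ, t ^ (2 * n) = |t| ^ (2 * n) := fun t => by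
        rw [pow_mul, pow_mul, sq_abs]
      have h1 : a ^ (2 * n) * μ.real {t | a ^ (2 * n) ≤ t ^ (2 * n)} ≤ ∫ t, t ^ (2 * n) ∂μ :=
        mul_meas_ge_le_integral_of_nonneg
          (Eventually.of_forall fun t => by rw [Pi.zero_apply, hsq]; positivity) (hμ (2 * n)).1 _
      have h2 : μ.real {t | a ≤ |t|} ≤ μ.real {t | a ^ (2 * n) ≤ t ^ (2 * n)} := by
        refine measureReal_mono (fun t ht => ?_)
        change a ^ (2 * n) ≤ t ^ (2 * n)
        rw [hsq t]
        exact pow_le_pow_left₀ ha.le ht _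
      rw [(hμ (2 * n)).2] at h1
      have h3 := (le_abs_self _).trans (hcauchy (2 * n + 1))
      have h4 : a ^ (2 * n) * μ.real {t | a ≤ |t|} ≤ C / r ^ (2 * n + 1) :=
        ((mul_le_mul_of_nonneg_left h2 (by positivity)).trans h1).trans h3
      have h5 : C / r * ((1 / (r * a)) ^ 2) ^ n = C / r ^ (2 * n + 1) / a ^ (2 * n) := by
        rw [← pow_mul, div_pow, one_pow, mul_pow, pow_succ]
        field_simp
      rw [h5, le_div_iff₀ (by positivity)]
      linarith
    have hq : Tendsto (fun n : ℕ => C / r * ((1 / (r * a)) ^ 2) ^ n) atTop (𝓝 (C / r * 0)) := by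
      refine (tendsto_pow_atTop_nhds_zero_of_lt_one (by positivity) ?_).const_mul _
      rw [div_pow, one_pow, div_lt_one (by positivity)]
      exact one_lt_pow₀ hra two_ne_zero
    rw [mul_zero] at hq
    have h0 : μ.real {t | a ≤ |t|} ≤ 0 := ge_of_tendsto' hq hmark
    exact (measureReal_eq_zero_iff).1 (le_antisymm h0 measureReal_nonneg)
  intro s hs
  refine abs_le.1 ?_
  by_contra! hlt
  obtain ⟨a, ha1, ha2⟩ := exists_between hlt
  have ha : 0 < a := (by positivity : 0 < 1 / ρ).trans ha1
  obtain ⟨r, hr1, hr2⟩ := exists_between (show 1 / a < ρ from by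
    rw [div_lt_iff₀ ha]; rwa [div_lt_iff₀ hρ, mul_comm] at ha1)
  refine Measure.notMem_support_iff_exists.2 ⟨{t | a ≤ |t|}, ?_, ?_⟩ hs
  · exact continuous_abs.continuousAt.eventually (eventually_ge_nhds ha2)
  · refine key r a ((by positivity : 0 < 1 / a).trans hr1) hr2 ?_
    rwa [div_lt_iff₀ ha] at hr1

/-! ### Continuation of `V` to the strip -/

section
variable {R : ℝ≥0∞} {ϑ f₁ f₂ : ℝ → ℝ} {H : ℂ → ℂ} {x : ℝ}

/-- The Möbius transform of `H` that equals `V f₁ f₂ x` on the real axis if `H = f₂ / f₁`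
there. -/
noncomputable def moebiusV (f₁ f₂ : ℝ → ℝ) (x : ℝ) (H : ℂ → ℂ) (z : ℂ) : ℂ :=
  (f₁ x * H z - f₂ x) / (deriv f₂ x - deriv f₁ x * H z)

lemma moebius_denom_ne_zero {h : ℂ} (a b c d : ℝ) (hW : a * d - c * b ≠ 0) (hh : h.im ≠ 0) :
    (d : ℂ) - c * h ≠ 0 := by
  intro h0
  have him := congrArg Complex.im h0
  have hre := congrArg Complex.re h0
  simp at him hre
  rcases him with hc | hc
  · apply hW
    rw [hc] at hre ⊢
    simp at hre
    rw [hre]; ring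
  · exact hh hc

/-- A real Möbius transformation multiplies the imaginary part by its determinant over the squared
modulus of the denominator. -/
lemma moebius_im {h : ℂ} (a b c d : ℝ) :
    ((a * h - b) / (d - c * h)).im = (a * d - c * b) * h.im / normSq (d - c * h) := by
  rw [Complex.div_im]
  simp
  ring

lemma moebiusV_ofReal (hϑ : Continuous ϑ) (hf : IsSolutionPair ϑ f₁ f₂) {t : ℝ}
    (hH : H t = ((f₂ t / f₁ t : ℝ) : ℂ)) (ht : f₁ t ≠ 0) :
    moebiusV f₁ f₂ x H t = V f₁ f₂ x t := by
  have hW := hf.wronskian_ne_zero hϑ x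
  rw [V_eq, moebiusV, hH, sinSol, cosSol]
  norm_cast
  have h1 : f₁ x * (f₂ t / f₁ t) - f₂ x =
      (-f₂ x / wronskian f₁ f₂ x * f₁ t + f₁ x / wronskian f₁ f₂ x * f₂ t) *
        (wronskian f₁ f₂ x / f₁ t) := by field_simp; ring
  have h2 : deriv f₂ x - deriv f₁ x * (f₂ t / f₁ t) =
      (deriv f₂ x / wronskian f₁ f₂ x * f₁ t + -deriv f₁ x / wronskian f₁ f₂ x * f₂ t) *
        (wronskian f₁ f₂ x / f₁ t) := by field_simp; ring
  rw [h1, h2, mul_div_mul_right _ _ (div_ne_zero hW ht)]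

/-- Zeros of a member of an independent pair of solutions are isolated. -/
lemma IsSolutionPair.eventually_ne_zero (hϑ : Continuous ϑ) (hf : IsSolutionPair ϑ f₁ f₂)
    (t₀ : ℝ) : ∀ᶠ t in 𝓝[≠] t₀, f₁ t ≠ 0 := by
  by_cases h : f₁ t₀ = 0
  · have hd : deriv f₁ t₀ ≠ 0 := fun hd => hf.wronskian_ne_zero hϑ t₀ (by
      rw [wronskian, h, hd]; ring)
    exact (hf.left.hasDerivAt t₀).eventually_ne hd
  · exact ((hf.left.hasDerivAt t₀).continuousAt.eventually_ne h).filter_mono nhdsWithin_le_nhds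

lemma tendsto_ofReal_nhdsNE (t₀ : ℝ) :
    Tendsto (fun t : ℝ => (t : ℂ)) (𝓝[≠] t₀) (𝓝[≠] (t₀ : ℂ)) :=
  tendsto_nhdsWithin_iff.2
    ⟨(continuous_ofReal.tendsto t₀).mono_left nhdsWithin_le_nhds, by
      filter_upwards [self_mem_nhdsWithin] with t ht
      simpa using ht⟩

lemma continuousAt_V (hf : IsSolutionPair ϑ f₁ f₂) {t₀ : ℝ} (hc : cosSol f₁ f₂ x t₀ ≠ 0) :
    ContinuousAt (V f₁ f₂ x) t₀ := by
  have h : V f₁ f₂ x = fun t => sinSol f₁ f₂ x t / cosSol f₁ f₂ x t := funext (V_eq f₁ f₂ x)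
  rw [h]
  exact ((hf.sinSol_isSolution x).hasDerivAt t₀).continuousAt.div
    ((hf.cosSol_isSolution x).hasDerivAt t₀).continuousAt hc

/-- At a real point that is not a pole of `V`, the meromorphic function `moebiusV` has a removable
singularity, as it is bounded on the real axis. -/
lemma exists_analyticAt_moebiusV (hϑ : Continuous ϑ) (hf : IsSolutionPair ϑ f₁ f₂) {t₀ : ℝ}
    (hH : MeromorphicAt H t₀)
    (hHf : ∀ t : ℝ, f₁ t ≠ 0 → H (t : ℂ) = ((f₂ t / f₁ t : ℝ) : ℂ))
    (hc : cosSol f₁ f₂ x t₀ ≠ 0) :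
    ∃ N : ℂ → ℂ, AnalyticAt ℂ N t₀ ∧ (∀ z : ℂ, z ≠ t₀ → N z = moebiusV f₁ f₂ x H z) ∧
      ∀ᶠ t : ℝ in 𝓝 t₀, N t = V f₁ f₂ x t := by
  have hM : MeromorphicAt (moebiusV f₁ f₂ x H) t₀ := by
    have c : ∀ a : ℝ, MeromorphicAt (fun _ : ℂ => (a : ℂ)) t₀ := fun a => MeromorphicAt.const _ _
    exact (((c _).mul hH).sub (c _)).div ((c _).sub ((c _).mul hH))
  have hreal : ∀ᶠ t : ℝ in 𝓝[≠] t₀, moebiusV f₁ f₂ x H t = V f₁ f₂ x t := by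
    filter_upwards [hf.eventually_ne_zero hϑ t₀] with t ht
    exact moebiusV_ofReal hϑ hf (hHf t ht) ht
  have hVlim : Tendsto (fun t : ℝ => (V f₁ f₂ x t : ℂ)) (𝓝[≠] t₀) (𝓝 (V f₁ f₂ x t₀ : ℂ)) :=
    ((continuous_ofReal.tendsto _).comp (continuousAt_V hf hc)).mono_left nhdsWithin_le_nhds
  have hord : 0 ≤ meromorphicOrderAt (moebiusV f₁ f₂ x H) t₀ := by
    by_contra! hneg
    have h1 := (tendsto_cobounded_iff_meromorphicOrderAt_neg hM).2 hneg
    have h2 := (h1.comp (tendsto_ofReal_nhdsNE t₀)).congr' hreal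
    exact h2.not_tendsto (Metric.disjoint_nhds_cobounded _).symm hVlim
  have hN := (hM.meromorphicOrderAt_nonneg_iff_analyticAt_toMeromorphicNFAt).1 hord
  refine ⟨_, hN, fun z hz => (hM.eqOn_compl_singleton_toMeromorphicNFAt hz).symm, ?_⟩
  have hreal' : ∀ᶠ t : ℝ in 𝓝[≠] t₀,
      toMeromorphicNFAt (moebiusV f₁ f₂ x H) t₀ t = V f₁ f₂ x t := by
    filter_upwards [hreal, self_mem_nhdsWithin] with t ht hne
    rw [← ht]
    exact (hM.eqOn_compl_singleton_toMeromorphicNFAt (by simpa using hne)).symm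
  have hNlim : Tendsto (fun t : ℝ => toMeromorphicNFAt (moebiusV f₁ f₂ x H) t₀ t) (𝓝[≠] t₀)
      (𝓝 (toMeromorphicNFAt (moebiusV f₁ f₂ x H) t₀ t₀)) :=
    (hN.continuousAt.tendsto.mono_left nhdsWithin_le_nhds).comp (tendsto_ofReal_nhdsNE t₀)
  have h0 := tendsto_nhds_unique (hNlim.congr' hreal') hVlim
  filter_upwards [eventually_nhdsWithin_iff.1 hreal'] with t ht
  rcases eq_or_ne t t₀ with rfl | hne
  · exact h0
  · exact ht hne

/-- A function that is analytic at a real point and real on the real axis near it commutes with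
complex conjugation near it. -/
lemma eventually_conj_eq {N : ℂ → ℂ} {v : ℝ → ℝ} {t₀ : ℝ} (hN : AnalyticAt ℂ N t₀)
    (hv : ∀ᶠ t : ℝ in 𝓝 t₀, N t = v t) :
    ∀ᶠ z in 𝓝 (t₀ : ℂ), (starRingEnd ℂ) (N ((starRingEnd ℂ) z)) = N z := by
  have hconj : Tendsto (starRingEnd ℂ) (𝓝 (t₀ : ℂ)) (𝓝 (t₀ : ℂ)) := by
    simpa using continuous_conj.tendsto (t₀ : ℂ)
  have hA : AnalyticAt ℂ (fun z => (starRingEnd ℂ) (N ((starRingEnd ℂ) z))) t₀ := by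
    rw [Complex.analyticAt_iff_eventually_differentiableAt]
    filter_upwards [hconj.eventually hN.eventually_analyticAt] with z hz
    have h := hz.differentiableAt.conj_conj
    simpa [Function.comp_def] using h
  refine (hA.frequently_eq_iff_eventually_eq hN).1 ?_
  refine (tendsto_ofReal_nhdsNE t₀).frequently (Eventually.frequently ?_)
  filter_upwards [hv.filter_mono nhdsWithin_le_nhds] with t ht
  rw [conj_ofReal, ht, conj_ofReal]

/-- The function `moebiusV` above the real axis, its Schwarz reflection below it, and `V` on it. -/
noncomputable def reflectedV (f₁ f₂ : ℝ → ℝ) (x : ℝ) (H : ℂ → ℂ) (z : ℂ) : ℂ :=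
  if 0 < z.im then moebiusV f₁ f₂ x H z
  else if z.im < 0 then (starRingEnd ℂ) (moebiusV f₁ f₂ x H ((starRingEnd ℂ) z))
  else V f₁ f₂ x z.re

lemma reflectedV_ofReal (t : ℝ) : reflectedV f₁ f₂ x H t = V f₁ f₂ x t := by
  simp [reflectedV]

lemma differentiableAt_moebiusV (hϑ : Continuous ϑ) (hf : IsSolutionPair ϑ f₁ f₂) {z : ℂ}
    (hH : DifferentiableAt ℂ H z) (him : (H z).im ≠ 0) :
    DifferentiableAt ℂ (moebiusV f₁ f₂ x H) z := by
  refine ((hH.const_mul _).sub_const _).div ((hH.const_mul _).const_sub _) ?_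
  exact moebius_denom_ne_zero (f₁ x) (f₂ x) (deriv f₁ x) (deriv f₂ x)
    (hf.wronskian_ne_zero hϑ x) him

lemma differentiableAt_reflectedV_upper (hϑ : Continuous ϑ) (hf : IsSolutionPair ϑ f₁ f₂) {z : ℂ}
    (hz : 0 < z.im) (hH : DifferentiableAt ℂ H z) (him : (H z).im ≠ 0) :
    DifferentiableAt ℂ (reflectedV f₁ f₂ x H) z := by
  refine (differentiableAt_moebiusV (x := x) hϑ hf hH him).congr_of_eventuallyEq ?_
  filter_upwards [continuous_im.continuousAt.eventually (eventually_gt_nhds hz)] with w hw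
  exact if_pos hw

lemma differentiableAt_reflectedV_lower (hϑ : Continuous ϑ) (hf : IsSolutionPair ϑ f₁ f₂) {z : ℂ}
    (hz : z.im < 0) (hH : DifferentiableAt ℂ H ((starRingEnd ℂ) z))
    (him : (H ((starRingEnd ℂ) z)).im ≠ 0) :
    DifferentiableAt ℂ (reflectedV f₁ f₂ x H) z := by
  have h := (differentiableAt_moebiusV (x := x) hϑ hf hH him).conj_conj
  rw [conj_conj] at h
  refine h.congr_of_eventuallyEq ?_
  filter_upwards [continuous_im.continuousAt.eventually (eventually_lt_nhds hz)] with w hw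
  rw [reflectedV, if_neg (not_lt.2 (le_of_lt hw)), if_pos hw]
  rfl

lemma differentiableAt_reflectedV_ofReal (hϑ : Continuous ϑ) (hf : IsSolutionPair ϑ f₁ f₂) {t₀ : ℝ}
    (hH : MeromorphicAt H t₀)
    (hHf : ∀ t : ℝ, f₁ t ≠ 0 → H (t : ℂ) = ((f₂ t / f₁ t : ℝ) : ℂ))
    (hc : cosSol f₁ f₂ x t₀ ≠ 0) :
    DifferentiableAt ℂ (reflectedV f₁ f₂ x H) t₀ := by
  obtain ⟨N, hN, hNM, hNV⟩ := exists_analyticAt_moebiusV hϑ hf hH hHf hc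
  refine hN.differentiableAt.congr_of_eventuallyEq ?_
  have hre : ∀ᶠ z : ℂ in 𝓝 (t₀ : ℂ), N (z.re : ℂ) = V f₁ f₂ x z.re := by
    have : Tendsto re (𝓝 (t₀ : ℂ)) (𝓝 t₀) := by simpa using continuous_re.tendsto (t₀ : ℂ)
    exact this.eventually hNV
  filter_upwards [eventually_conj_eq hN hNV, hre] with z hz hzre
  unfold reflectedV
  split_ifs with h1 h2
  · exact (hNM z (fun h => by simp [h] at h1)).symm
  · rw [← hz, hNM _ (fun h => ?_)]
    have := congrArg Complex.im h
    simp at this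
    linarith
  · have : z = (z.re : ℂ) := Complex.ext rfl (by simp; linarith)
    rw [← hzre, ← this]

lemma reflectedV_im_pos (hϑ : Continuous ϑ) (hf : IsSolutionPair ϑ f₁ f₂) {z : ℂ} (hz : 0 < z.im)
    (him : 0 < wronskian f₁ f₂ 0 * (H z).im * z.im) : 0 < (reflectedV f₁ f₂ x H z).im := by
  have h1 : 0 < wronskian f₁ f₂ x * (H z).im := by
    rw [hf.left.wronskian_eq hf.right x 0]
    exact pos_of_mul_pos_left him hz.le
  rw [reflectedV, if_pos hz, moebiusV, moebius_im]
  refine div_pos h1 (normSq_pos.2 ?_)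
  exact moebius_denom_ne_zero (f₁ x) (f₂ x) (deriv f₁ x) (deriv f₂ x)
    (hf.wronskian_ne_zero hϑ x) (fun h => by simp [h] at h1)

end

/-! ### The change of variable `g_R` -/

/-- The holomorphic extension of `g_R`, defined by the principal branch of the logarithm. -/
noncomputable def gC (R : ℝ≥0∞) (w : ℂ) : ℂ :=
  if R = ⊤ then w
  else -(R.toReal / Real.pi : ℝ) * Complex.log (1 - (Real.pi / R.toReal : ℝ) * w)

/-- For `d > 0`, the radius of the largest disc about `0` whose real points are mapped into
`(-d, d)` by `g_R`; it is determined by the right end point `g_R⁻¹(d)`. -/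
noncomputable def gRadius (R : ℝ≥0∞) (d : ℝ) : ℝ :=
  if R = ⊤ then d
  else R.toReal / Real.pi * (1 - Real.exp (-(Real.pi * d / R.toReal)))

section
variable {R : ℝ≥0∞}

lemma gRadius_pos (hR : 0 < R) {d : ℝ} (hd : 0 < d) : 0 < gRadius R d := by
  unfold gRadius
  split_ifs with h
  · exact hd
  · have hr : 0 < R.toReal := ENNReal.toReal_pos hR.ne' h
    have : Real.exp (-(Real.pi * d / R.toReal)) < 1 := by
      rw [Real.exp_lt_one_iff]
      have := Real.pi_pos
      simp only [Left.neg_neg_iff]; positivity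
    have h2 := Real.pi_pos
    exact mul_pos (by positivity) (by linarith)

lemma boundPos_eq (hR : 0 < R) {K : ℝ} (hK : 0 < K) :
    boundPos R K = 1 / gRadius R (Real.pi / (2 * Real.sqrt K)) := by
  have hs := Real.sqrt_pos.2 hK
  have hp := Real.pi_pos
  unfold boundPos gRadius
  split_ifs with h
  · field_simp
  · have hr : 0 < R.toReal := ENNReal.toReal_pos hR.ne' h
    have : Real.pi * (Real.pi / (2 * Real.sqrt K)) / R.toReal =
        Real.pi ^ 2 / (2 * R.toReal * Real.sqrt K) := by field_simp
    rw [this, one_div, mul_inv, inv_div, ← div_eq_mul_inv, div_div, mul_sub, mul_one]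

lemma tendsto_boundPos (hR : 0 < R) :
    Tendsto (boundPos R) (𝓝[>] 0) (𝓝 (boundNonpos R)) := by
  have hsqrt : Tendsto Real.sqrt (𝓝[>] 0) (𝓝[>] 0) := by
    refine tendsto_nhdsWithin_iff.2 ⟨?_, ?_⟩
    · have := Real.continuous_sqrt.tendsto 0
      rw [Real.sqrt_zero] at this
      exact this.mono_left nhdsWithin_le_nhds
    · filter_upwards [self_mem_nhdsWithin] with t ht using Real.sqrt_pos.2 ht
  by_cases h : R = ⊤
  · have h0 : boundNonpos R = 2 * 0 / Real.pi := by simp [boundNonpos, h]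
    rw [h0]
    refine ((((tendsto_nhdsWithin_iff.1 hsqrt).1).const_mul 2).div_const Real.pi).congr fun K => ?_
    simp [boundPos, h]
  · have hr : 0 < R.toReal := ENNReal.toReal_pos hR.ne' h
    have hp := Real.pi_pos
    have h1 : Tendsto (fun K => Real.pi ^ 2 / (2 * R.toReal) * (Real.sqrt K)⁻¹) (𝓝[>] 0) atTop :=
      (tendsto_inv_nhdsGT_zero.comp hsqrt).const_mul_atTop (by positivity)
    have h2 := (Real.tendsto_exp_neg_atTop_nhds_zero.comp h1).const_mul R.toReal
    have h3 := h2.const_sub R.toReal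
    have h4 := (tendsto_const_nhds (x := Real.pi)).div h3 (by simpa using hr.ne')
    simp only [mul_zero, sub_zero] at h4
    have h0 : boundNonpos R = Real.pi / R.toReal := by simp [boundNonpos, h]
    rw [h0]
    refine h4.congr fun K => ?_
    simp only [boundPos, h, if_false, Function.comp_apply, Pi.div_apply]
    rw [← div_eq_mul_inv, div_div]

lemma im_one_sub (p : ℝ) (w : ℂ) : (1 - (p : ℂ) * w).im = -(p * w.im) := by
  simp

lemma differentiableAt_gC_of_im_ne (hR : 0 < R) {w : ℂ} (hw : w.im ≠ 0) :
    DifferentiableAt ℂ (gC R) w := by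
  unfold gC
  split_ifs with h
  · exact differentiableAt_id
  · have hr : 0 < R.toReal := ENNReal.toReal_pos hR.ne' h
    refine DifferentiableAt.const_mul (DifferentiableAt.clog (by fun_prop) ?_) _
    rw [mem_slitPlane_iff]
    right
    rw [im_one_sub]
    have := Real.pi_pos
    exact neg_ne_zero.2 (mul_ne_zero (by positivity) hw)

lemma gC_mem_upperStrip (hR : 0 < R) {w : ℂ} (hw : 0 < w.im) : gC R w ∈ upperStrip R := by
  unfold gC upperStrip
  split_ifs with h
  · simp [h, hw]
  · have hr : 0 < R.toReal := ENNReal.toReal_pos hR.ne' h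
    have hp := Real.pi_pos
    set z : ℂ := 1 - (Real.pi / R.toReal : ℝ) * w with hz
    have hzim : z.im < 0 := by
      rw [hz, im_one_sub]
      have : 0 < Real.pi / R.toReal * w.im := by positivity
      linarith
    have h1 : z.arg < 0 := arg_neg_iff.2 hzim
    have h2 : -Real.pi < z.arg := neg_pi_lt_arg z
    have him : (-((R.toReal / Real.pi : ℝ) : ℂ) * Complex.log z).im =
        R.toReal / Real.pi * (-z.arg) := by
      rw [neg_mul, neg_im, im_ofReal_mul, log_im]; ring
    have h3 : R.toReal / Real.pi * (-z.arg) < R.toReal := by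
      calc R.toReal / Real.pi * (-z.arg) < R.toReal / Real.pi * Real.pi := by
            have : -z.arg < Real.pi := by linarith
            gcongr
        _ = R.toReal := by field_simp
    refine ⟨by rw [him]; exact mul_pos (by positivity) (by linarith), ?_⟩
    rw [him]
    exact (ENNReal.ofReal_lt_iff_lt_toReal (mul_pos (by positivity) (by linarith)).le h).2 h3

lemma gC_conj (hR : 0 < R) {w : ℂ} (hw : w.im ≠ 0) :
    gC R ((starRingEnd ℂ) w) = (starRingEnd ℂ) (gC R w) := by
  unfold gC
  split_ifs with h
  · rfl
  · have hr : 0 < R.toReal := ENNReal.toReal_pos hR.ne' h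
    have hp := Real.pi_pos
    set z : ℂ := 1 - (Real.pi / R.toReal : ℝ) * w with hz
    have hzim : z.im ≠ 0 := by
      rw [hz, im_one_sub]
      exact neg_ne_zero.2 (mul_ne_zero (by positivity) hw)
    have h1 : 1 - ((Real.pi / R.toReal : ℝ) : ℂ) * (starRingEnd ℂ) w = (starRingEnd ℂ) z := by
      rw [hz, map_sub, map_mul, conj_ofReal, map_one]
    rw [h1, log_conj _ (fun ha => hzim ((arg_eq_pi_iff.1 ha).2)), map_mul, map_neg, conj_ofReal]

lemma one_sub_pos_of_lt_gRadius (hR : 0 < R) (h : R ≠ ⊤) {d t : ℝ} (ht : |t| < gRadius R d) :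
    Real.exp (-(Real.pi * d / R.toReal)) < 1 - Real.pi / R.toReal * t := by
  have hr : 0 < R.toReal := ENNReal.toReal_pos hR.ne' h
  have hp := Real.pi_pos
  have ht' := (le_abs_self t).trans_lt ht
  simp only [gRadius, h, if_false] at ht'
  have : Real.pi / R.toReal * t < 1 - Real.exp (-(Real.pi * d / R.toReal)) := by
    calc Real.pi / R.toReal * t < Real.pi / R.toReal * (R.toReal / Real.pi *
          (1 - Real.exp (-(Real.pi * d / R.toReal)))) := by gcongr
      _ = _ := by field_simp
  linarith

lemma gC_ofReal (hR : 0 < R) {d t : ℝ} (ht : |t| < gRadius R d) : gC R t = gR R t := by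
  unfold gC gR
  split_ifs with h
  · rfl
  · have h1 := (Real.exp_pos _).trans (one_sub_pos_of_lt_gRadius hR h ht)
    have h2 : (1 : ℂ) - (Real.pi / R.toReal : ℝ) * t = ((1 - Real.pi / R.toReal * t : ℝ) : ℂ) := by
      push_cast; ring
    rw [h2, ← ofReal_log h1.le, show Real.pi * t / R.toReal = Real.pi / R.toReal * t by ring]
    push_cast; rfl

lemma differentiableAt_gC_ofReal (hR : 0 < R) {d t : ℝ} (ht : |t| < gRadius R d) :
    DifferentiableAt ℂ (gC R) t := by
  unfold gC
  split_ifs with h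
  · exact differentiableAt_id
  · refine DifferentiableAt.const_mul (DifferentiableAt.clog (by fun_prop) ?_) _
    have h1 := (Real.exp_pos _).trans (one_sub_pos_of_lt_gRadius hR h ht)
    have h2 : (1 : ℂ) - (Real.pi / R.toReal : ℝ) * t = ((1 - Real.pi / R.toReal * t : ℝ) : ℂ) := by
      push_cast; ring
    rw [h2]
    exact ofReal_mem_slitPlane.2 h1

lemma abs_gR_lt (hR : 0 < R) {d t : ℝ} (ht : |t| < gRadius R d) : |gR R t| < d := by
  by_cases h : R = ⊤
  · simpa [gR, gRadius, h] using ht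
  · have hr : 0 < R.toReal := ENNReal.toReal_pos hR.ne' h
    have hp := Real.pi_pos
    have h1 := one_sub_pos_of_lt_gRadius hR h ht
    have h2 := one_sub_pos_of_lt_gRadius hR h (d := d) (t := -t) (by rwa [abs_neg])
    set a := Real.pi * d / R.toReal with ha
    set y := 1 - Real.pi / R.toReal * t with hy
    have hy0 : 0 < y := (Real.exp_pos _).trans h1
    -- the left endpoint is the easier one, as `2 - exp (-a) ≤ exp a`
    have h3 : y < Real.exp a := by
      have hmul : Real.exp a * Real.exp (-a) = 1 := by rw [← Real.exp_add]; simp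
      have h4 : y < 2 - Real.exp (-a) := by rw [hy]; linarith
      have h5 : 2 ≤ Real.exp a + Real.exp (-a) := by
        nlinarith [sq_nonneg (Real.exp a - Real.exp (-a)), Real.exp_pos a, Real.exp_pos (-a)]
      linarith
    have h6 : -a < Real.log y := (Real.lt_log_iff_exp_lt hy0).2 h1
    have h7 : Real.log y < a := (Real.log_lt_iff_lt_exp hy0).2 h3
    have h8 : gR R t = -(R.toReal / Real.pi * Real.log y) := by
      simp only [gR, h, if_false, hy]
      rw [show Real.pi * t / R.toReal = Real.pi / R.toReal * t by ring]; ring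
    rw [h8, abs_neg, abs_mul, abs_of_pos (by positivity : 0 < R.toReal / Real.pi)]
    calc R.toReal / Real.pi * |Real.log y| < R.toReal / Real.pi * a := by
          have := abs_lt.2 ⟨h6, h7⟩
          gcongr
      _ = d := by rw [ha]; field_simp

end

/-! ### The Pick function whose Taylor coefficients are the Schwarzians -/

section
variable {R : ℝ≥0∞} {ϑ f₁ f₂ : ℝ → ℝ} {H : ℂ → ℂ} {x : ℝ}

/-- The holomorphic extension of `t ↦ V f₁ f₂ x (x + g_R t)`. -/
noncomputable def pickV (R : ℝ≥0∞) (f₁ f₂ : ℝ → ℝ) (x : ℝ) (H : ℂ → ℂ) (w : ℂ) : ℂ :=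
  reflectedV f₁ f₂ x H (x + gC R w)

lemma ofReal_add_mem_upperStrip {z : ℂ} (hz : z ∈ upperStrip R) : (x : ℂ) + z ∈ upperStrip R := by
  simpa [upperStrip] using hz

lemma pickV_upper (hR : 0 < R) (hϑ : Continuous ϑ) (hf : IsSolutionPair ϑ f₁ f₂)
    (hH : AnalyticOnNhd ℂ H (upperStrip R))
    (hpos : ∀ z ∈ upperStrip R, 0 < wronskian f₁ f₂ 0 * (H z).im * z.im) {w : ℂ} (hw : 0 < w.im) :
    DifferentiableAt ℂ (pickV R f₁ f₂ x H) w ∧ 0 < (pickV R f₁ f₂ x H w).im := by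
  have hz := ofReal_add_mem_upperStrip (x := x) (gC_mem_upperStrip hR hw)
  have him := hpos _ hz
  refine ⟨?_, reflectedV_im_pos hϑ hf hz.1 him⟩
  have h1 := differentiableAt_reflectedV_upper (x := x) hϑ hf hz.1 (hH _ hz).differentiableAt
    (fun h => by simp [h] at him)
  exact DifferentiableAt.comp (f := fun w => (x : ℂ) + gC R w) w h1
    ((differentiableAt_gC_of_im_ne hR hw.ne').const_add _)

lemma pickV_differentiableOn (hR : 0 < R) (hϑ : Continuous ϑ) (hf : IsSolutionPair ϑ f₁ f₂)
    (hM : MeromorphicOn H (strip R)) (hH : AnalyticOnNhd ℂ H (upperStrip R))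
    (hpos : ∀ z ∈ upperStrip R, 0 < wronskian f₁ f₂ 0 * (H z).im * z.im)
    (hHf : ∀ t : ℝ, f₁ t ≠ 0 → H (t : ℂ) = ((f₂ t / f₁ t : ℝ) : ℂ)) {d : ℝ}
    (hd : ∀ t, |t - x| < d → cosSol f₁ f₂ x t ≠ 0) :
    DifferentiableOn ℂ (pickV R f₁ f₂ x H) (ball 0 (gRadius R d)) := by
  intro w hw
  refine DifferentiableAt.differentiableWithinAt ?_
  rcases lt_trichotomy w.im 0 with h | h | h
  · have hg : gC R w = (starRingEnd ℂ) (gC R ((starRingEnd ℂ) w)) := by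
      rw [gC_conj hR h.ne, conj_conj]
    have hz := ofReal_add_mem_upperStrip (x := x)
      (gC_mem_upperStrip hR (w := (starRingEnd ℂ) w) (by simpa using h))
    have hconj : (starRingEnd ℂ) ((x : ℂ) + gC R w) = x + gC R ((starRingEnd ℂ) w) := by
      rw [hg, map_add, conj_conj, conj_ofReal]
    rw [← hconj] at hz
    have him := hpos _ hz
    have h1 := differentiableAt_reflectedV_lower (x := x) hϑ hf (z := x + gC R w)
      (by simpa using hz.1) (hH _ hz).differentiableAt (fun h => by simp only [h] at him; simp at him)
    exact DifferentiableAt.comp (f := fun w => (x : ℂ) + gC R w) w h1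
      ((differentiableAt_gC_of_im_ne hR h.ne).const_add _)
  · obtain ⟨t, rfl⟩ : ∃ t : ℝ, w = t := ⟨w.re, Complex.ext rfl (by simpa using h)⟩
    have ht : |t| < gRadius R d := by simpa using hw
    have hx : (x : ℂ) + gC R t = ((x + gR R t : ℝ) : ℂ) := by rw [gC_ofReal hR ht, ofReal_add]
    have h1 := differentiableAt_reflectedV_ofReal (x := x) (t₀ := x + gR R t) hϑ hf
      (hM _ (by simpa [strip] using hR)) hHf (hd _ (by simpa using abs_gR_lt hR ht))
    rw [← hx] at h1
    exact DifferentiableAt.comp (f := fun w => (x : ℂ) + gC R w) (t : ℂ) h1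
      ((differentiableAt_gC_ofReal hR ht).const_add _)
  · exact (pickV_upper hR hϑ hf hH hpos h).1

lemma pickV_ofReal (hR : 0 < R) {d t : ℝ} (ht : |t| < gRadius R d) :
    pickV R f₁ f₂ x H t = V f₁ f₂ x (x + gR R t) := by
  rw [pickV, gC_ofReal hR ht, ← ofReal_add, reflectedV_ofReal]

lemma exists_pos_forall_cosSol_ne_zero (hϑ : Continuous ϑ) (hf : IsSolutionPair ϑ f₁ f₂) (x : ℝ) :
    ∃ d, 0 < d ∧ ∀ t, |t - x| < d → cosSol f₁ f₂ x t ≠ 0 := by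
  have h := ((hf.cosSol_isSolution x).hasDerivAt x).continuousAt.eventually_ne
    (show cosSol f₁ f₂ x x ≠ 0 by rw [hf.cosSol_self hϑ]; exact one_ne_zero)
  obtain ⟨d, hd, h⟩ := Metric.eventually_nhds_iff.1 h
  exact ⟨d, hd, fun t ht => h (by rwa [Real.dist_eq])⟩

end

lemma representsAsMoments_iff (S : ℕ → ℝ) (μ : Measure ℝ) : RepresentsAsMoments S μ ↔
    ∀ n : ℕ, Integrable (fun t : ℝ => t ^ n) μ ∧
      ∫ t, t ^ n ∂μ = S (n + 1) / (n + 1).factorial := by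
  constructor
  · intro h n
    obtain ⟨h1, h2⟩ := h (n + 1) (Nat.le_add_left 1 n)
    rw [Nat.add_sub_cancel] at h1 h2
    exact ⟨h1, by rw [h2]; field_simp⟩
  · intro h n hn
    obtain ⟨m, rfl⟩ := Nat.exists_eq_add_of_le' hn
    rw [Nat.add_sub_cancel]
    exact ⟨(h m).1, by rw [(h m).2]; field_simp⟩

end StripSchwarzian

theorem mainTheorem9
    (R : ℝ≥0∞) (hR : 0 < R)
    (ϑ : ℝ → ℝ) (hϑ : ContDiff ℝ ∞ ϑ)
    -- a pair of independent solutions whose quotient extends to the strip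
    (f₁ f₂ : ℝ → ℝ) (hf : StripSchwarzian.IsSolutionPair ϑ f₁ f₂)
    (hext : StripSchwarzian.QuotientExtends R f₁ f₂)
    -- any pair of independent solutions, from which the Schwarzians are computed
    (u₁ u₂ : ℝ → ℝ) (hu : StripSchwarzian.IsSolutionPair ϑ u₁ u₂)
    (x : ℝ) :
    (∃ μ : Measure ℝ, StripSchwarzian.RepresentsAsMoments
        (fun n => StripSchwarzian.gSchwarzian R u₁ u₂ n x) μ) ∧
    ∀ μ : Measure ℝ,
      StripSchwarzian.RepresentsAsMoments
        (fun n => StripSchwarzian.gSchwarzian R u₁ u₂ n x) μ →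
      ∀ K : ℝ, IsLUB (Set.range ϑ) K →
        (K ≤ 0 → μ.support ⊆
          Set.Icc (-StripSchwarzian.boundNonpos R) (StripSchwarzian.boundNonpos R)) ∧
        (0 < K → μ.support ⊆
          Set.Icc (-StripSchwarzian.boundPos R K) (StripSchwarzian.boundPos R K)) := by
  open StripSchwarzian in
  have hc := hϑ.continuous
  obtain ⟨H, hM, hH, hpos, hHf⟩ := hext
  simp only [representsAsMoments_iff, gSchwarzian, hu.V_congr hc hf]
  refine ⟨?_, fun μ hμ K hK => ?_⟩
  · obtain ⟨d, hd, hne⟩ := exists_pos_forall_cosSol_ne_zero hc hf x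
    exact exists_measure_of_pick (gRadius_pos hR hd)
      (pickV_differentiableOn hR hc hf hM hH hpos hHf hne) (fun t ht => pickV_ofReal hR ht)
      (fun w hw => (pickV_upper hR hc hf hH hpos hw).1)
      (fun w hw => (pickV_upper hR hc hf hH hpos hw).2.le)
  · have key : ∀ L, 0 < L → K ≤ L → μ.support ⊆ Icc (-boundPos R L) (boundPos R L) := by
      intro L hL hKL
      have hs := Real.sqrt_pos.2 hL
      have hne : ∀ t, |t - x| < Real.pi / (2 * Real.sqrt L) → cosSol f₁ f₂ x t ≠ 0 := fun t ht =>
        (hf.cosSol_isSolution x).ne_zero_of_le_sq hs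
          (fun s => by rw [Real.sq_sqrt hL.le]; exact (hK.1 ⟨s, rfl⟩).trans hKL)
          (hf.cosSol_self hc x) (hf.deriv_cosSol_self x) ht
      rw [boundPos_eq hR hL]
      exact support_subset_of_moments (gRadius_pos hR (div_pos Real.pi_pos (by positivity)))
        (pickV_differentiableOn hR hc hf hM hH hpos hHf hne) (fun t ht => pickV_ofReal hR ht) hμ
    refine ⟨fun hK0 => ?_, fun hK0 => key K hK0 le_rfl⟩
    -- every positive number bounds `ϑ`, and the bounds converge as it tends to `0`
    intro s hs
    rw [mem_Icc, ← abs_le]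
    refine ge_of_tendsto (tendsto_boundPos hR) ?_
    filter_upwards [self_mem_nhdsWithin] with L hL
    exact abs_le.2 (key L hL (hK0.trans (le_of_lt hL)) hs)
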